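/- **Setting.** Let $\mathcal X,\mathcal Y$ be metric spaces, $\mu$ a Borel probability measure on $\mathcal X$, and $\nu=\sum_{j=1}^J \nu_j\delta_{y_j}$ with $y_1,\dots,y_J\in\mathcal Y$, $\nu_j>0$ and $\sum_j\nu_j=1$. Let $c:\mathcal X\times\mathcal Y\to\mathbb R$ be a lower semi-continuous cost with $0\le c(x,y)\le c_{\mathcal X}(x)+c_{\mathcal Y}(y)$ for all $(x,y)$, where $c_{\mathcal X}$ is $\mu$-integrable and $c_{\mathcal Y}$ is real-valued. For $\varepsilon>0$, $x\in\mathcal X$ and $v\in\mathbb R^J$ put $$h_\varepsilon(x,v)=\varepsilon+\varepsilon\log\Bigl(\sum_{j=1}^J \exp\Bigl(\frac{v_j-c(x,y_j)}{\varepsilon}\Bigr)\nu_j\Bigr)-\sum_{j=1}^J v_j\nu_j,\qquad H_\varepsilon(v)=\int_{\mathcal X} h_\varepsilon(x,v)\,d\mu(x),$$ $$G_\varepsilon(v)=\mathbb E\bigl[\nabla_v h_\varepsilon(X,v)\,\nabla_v h_\varepsilon(X,v)^T\bigr],\quad X\sim\mu .$$ Let $\boldsymbol v_J=J^{-1/2}(1,\dots,1)^T$,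 let $P_J=I_J-\boldsymbol v_J\boldsymbol v_J^T$, and let $v^*\in\langle\boldsymbol v_J\rangle^\perp$ be a minimizer of $H_\varepsilon$ over $\mathbb R^J$ (assumed to exist). Let $X_1,X_2,\dots$ be i.i.d. with law $\mu$, and let $\widehat V_0$ be a square integrable random vector, independent of $(X_n)_{n\ge1}$, that belongs to $\langle\boldsymbol v_J\rangle^\perp$ almost surely. The regularized stochastic Gauss-Newton (SGN) recursion, with parameters $\alpha\geq 0$, $\beta>0$ and $\gamma>0$, is defined by $S_0=I_J$ and, for $n\ge0$, $$\widehat V_{n+1}=P_J\bigl(\widehat V_n-n^\alpha S_n^{-1}\nabla_v h_\varepsilon(X_{n+1},\widehat V_n)\bigr),$$ $$S_{n+1}=S_n+\nabla_v h_\varepsilon(X_{n+1},\widehat V_n)\nabla_v h_\varepsilon(X_{n+1},\widehat V_n)^T+\gamma\Bigl(1+\Bigl\lfloor\frac{n+1}{J}\Bigr\rfloor\Bigr)^{-\beta}Z_{n+1}Z_{n+1}^T,$$ where $0^0=1$, $Z_k=\sqrt{\nu_{\ell_k}}\,e_{\ell_k}$ with $\ell_k=1+((k-1)\bmod J)$,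 and $(e_1,\dots,e_J)$ is the canonical basis of $\mathbb R^J$. **Theorem.** Assume that $\alpha\in[0,1/2)$ and $\alpha+\beta<1/2$. Then $$\lim_{n\to\infty}\widehat V_n=v^*\quad\text{a.s.}\qquad\text{and}\qquad \lim_{n\to\infty}\frac1n S_n=G_\varepsilon(v^*)\quad\text{a.s.}$$ -/

import Mathlib

open MeasureTheory ProbabilityTheory Filter Topology

noncomputable section

namespace SGN

/-- The function `h_ε(x, v)` of the semi-dual formulation of entropically regularized
semi-discrete optimal transport, where the target measure is `∑ j, ν j • δ_{y j}`. -/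
def h {J : ℕ} {𝒳 𝒴 : Type*} (ε : ℝ) (ν : Fin J → ℝ) (y : Fin J → 𝒴) (c : 𝒳 → 𝒴 → ℝ)
    (x : 𝒳) (v : EuclideanSpace ℝ (Fin J)) : ℝ :=
  ε + ε * Real.log (∑ j, Real.exp ((v j - c x (y j)) / ε) * ν j) - ∑ j, v j * ν j

/-- The semi-dual objective `H_ε(v) = ∫ h_ε(x, v) dμ(x)`. -/
def H {J : ℕ} {𝒳 𝒴 : Type*} [MeasurableSpace 𝒳] (ε : ℝ) (ν : Fin J → ℝ) (y : Fin J → 𝒴)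
    (c : 𝒳 → 𝒴 → ℝ) (μ : Measure 𝒳) (v : EuclideanSpace ℝ (Fin J)) : ℝ :=
  ∫ x, h ε ν y c x v ∂μ

/-- The gradient `∇_v h_ε(x, v)` with respect to the second variable. -/
def gradh {J : ℕ} {𝒳 𝒴 : Type*} (ε : ℝ) (ν : Fin J → ℝ) (y : Fin J → 𝒴) (c : 𝒳 → 𝒴 → ℝ)
    (x : 𝒳) (v : EuclideanSpace ℝ (Fin J)) : EuclideanSpace ℝ (Fin J) :=
  gradient (fun w => h ε ν y c x w) v

/-- The matrix `u uᵀ`. -/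
def outer {J : ℕ} (u : EuclideanSpace ℝ (Fin J)) : Matrix (Fin J) (Fin J) ℝ :=
  Matrix.vecMulVec u.ofLp u.ofLp

/-- `G_ε(v) = E[∇_v h_ε(X, v) ∇_v h_ε(X, v)ᵀ]` with `X ∼ μ` (entrywise expectation). -/
def G {J : ℕ} {𝒳 𝒴 : Type*} [MeasurableSpace 𝒳] (ε : ℝ) (ν : Fin J → ℝ) (y : Fin J → 𝒴)
    (c : 𝒳 → 𝒴 → ℝ) (μ : Measure 𝒳) (v : EuclideanSpace ℝ (Fin J)) :
    Matrix (Fin J) (Fin J) ℝ :=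
  Matrix.of fun i j => ∫ x, outer (gradh ε ν y c x v) i j ∂μ

/-- The unit vector `v_J = J^{-1/2} (1, …, 1)`. -/
def vJ (J : ℕ) : EuclideanSpace ℝ (Fin J) :=
  WithLp.toLp 2 fun _ => 1 / Real.sqrt J

/-- The orthogonal projection matrix `P_J = I_J - v_J v_Jᵀ` onto the orthogonal complement
of `v_J`. -/
def PJ (J : ℕ) : Matrix (Fin J) (Fin J) ℝ :=
  1 - outer (vJ J)

/-- The deterministic vectors `Z_k = √(ν_{ℓ_k}) e_{ℓ_k}`, `k ≥ 1`, where
`ℓ_k = 1 + ((k - 1) mod J)`; since `Fin J` counts from `0`, the index `ℓ_k` is the element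
of `Fin J` of value `(k - 1) % J`. -/
def Z {J : ℕ} (ν : Fin J → ℝ) (k : ℕ) : EuclideanSpace ℝ (Fin J) :=
  WithLp.toLp 2 fun j => if (j : ℕ) = (k - 1) % J then Real.sqrt (ν j) else 0

/-- The regularized stochastic Gauss-Newton recursion run on the samples
`x 0 = X₁, x 1 = X₂, …` from the initial value `v₀`. The `n`-th term is the pair `(V̂_n, S_n)`:
`S_0 = I_J`, `V̂_0 = v₀`, and, with `φ = ∇_v h_ε(X_{n+1}, V̂_n)`,
`V̂_{n+1} = P_J (V̂_n - n^α S_n⁻¹ φ)` and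
`S_{n+1} = S_n + φ φᵀ + γ (1 + ⌊(n+1)/J⌋)^{-β} Z_{n+1} Z_{n+1}ᵀ`.
Here `n / J` is the floored division of natural numbers. -/
def iter {J : ℕ} {𝒳 𝒴 : Type*} (ε : ℝ) (ν : Fin J → ℝ) (y : Fin J → 𝒴) (c : 𝒳 → 𝒴 → ℝ)
    (α β γ : ℝ) (v₀ : EuclideanSpace ℝ (Fin J)) (x : ℕ → 𝒳) :
    ℕ → EuclideanSpace ℝ (Fin J) × Matrix (Fin J) (Fin J) ℝ
  | 0 => (v₀, 1)
  | n + 1 =>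
    let V := (iter ε ν y c α β γ v₀ x n).1
    let S := (iter ε ν y c α β γ v₀ x n).2
    let φ := gradh ε ν y c (x n) V
    (WithLp.toLp 2
      (Matrix.mulVec (PJ J) (V.ofLp - ((n : ℝ) ^ α) • Matrix.mulVec S⁻¹ φ.ofLp)),
      S + outer φ + (γ * (1 + (((n + 1) / J : ℕ) : ℝ)) ^ (-β)) • outer (Z ν (n + 1)))

/-- The iterate `V̂_n` of the stochastic Gauss-Newton algorithm. -/
def V {J : ℕ} {𝒳 𝒴 : Type*} (ε : ℝ) (ν : Fin J → ℝ) (y : Fin J → 𝒴) (c : 𝒳 → 𝒴 → ℝ)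
    (α β γ : ℝ) (v₀ : EuclideanSpace ℝ (Fin J)) (x : ℕ → 𝒳) (n : ℕ) :
    EuclideanSpace ℝ (Fin J) :=
  (iter ε ν y c α β γ v₀ x n).1

/-- The pre-conditioning matrix `S_n` of the stochastic Gauss-Newton algorithm. -/
def S {J : ℕ} {𝒳 𝒴 : Type*} (ε : ℝ) (ν : Fin J → ℝ) (y : Fin J → 𝒴) (c : 𝒳 → 𝒴 → ℝ)
    (α β γ : ℝ) (v₀ : EuclideanSpace ℝ (Fin J)) (x : ℕ → 𝒳) (n : ℕ) :
    Matrix (Fin J) (Fin J) ℝ :=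
  (iter ε ν y c α β γ v₀ x n).2

end SGN

end

/-! The proof is a Lyapunov argument for `Y n = H (V n) - H vstar`. The Bregman remainder of `h x`
at `v` is `ε` times the gap in Jensen's inequality for the exponential, taken under the weights at
`v` (`h_sub_eq`). This gap is nonnegative, vanishes only for constant increments, and is at most
quadratic. Hence `h` and `H` are convex, strictly so modulo constants, have curvature bounded
uniformly in `x`, and have gradients of norm at most 2.

The projection changes `V` by a constant vector, which `H` does not see, so one step behaves like a
preconditioned gradient step (`H_V_succ_le`). Conditionally on the past, `Y` drops by `D n = n^α
⟨S⁻¹ ∇H, ∇H⟩` up to an error `b n` of order `(n^α ‖S⁻¹‖)²`. The deterministic terms `Z Zᵀ` alone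
force `S n ≥ κ (n+1)^(1-β)` (`exists_le_inner_S`), so `b n` is of order `n^(2(α+β-1))`, summable
because `α + β < 1/2`. Robbins–Siegmund then gives that `Y` converges and `∑ D n < ∞` almost surely.

Since `S n` grows at most linearly, `D n` dominates `‖∇H(V n)‖² / (n+1)` up to a constant. If the
limit of `Y` were positive, coercivity of `H` on zero-sum vectors (`exists_growth`) would keep `V n`
bounded, convexity would keep `‖∇H(V n)‖` away from 0, and the harmonic series would converge. So `Y
→ 0`, and strict convexity turns this into `V n → vstar`.

Finally `S n / n` is a Cesàro mean: the weights are continuous in `v` uniformly in `x`, so `V k` may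
be replaced by `vstar`; the regularization averages to 0, and the strong law does the rest. -/

noncomputable section

namespace SGN

/-! ### Jensen gap of the exponential: sign, strictness, quadratic bound. -/

section LogSumExp

variable {ι : Type*} [Fintype ι] {p t : ι → ℝ}

/-- The linear term on the right disappears on averaging a centred variable, which leaves a
sub-Gaussian bound on its exponential moment. -/
theorem exp_le_add_exp_sq (s : ℝ) : Real.exp s ≤ s + Real.exp (s ^ 2) := by
  rcases le_total |s| 1 with hs | hs
  · have h1 := (abs_le.1 (Real.abs_exp_sub_one_sub_id_le hs)).2
    have h2 := Real.add_one_le_exp (s ^ 2)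
    linarith
  · rcases le_abs'.1 hs with h | h
    · have h1 : Real.exp s ≤ 1 := Real.exp_le_one_iff.2 (by linarith)
      have h2 := Real.add_one_le_exp (s ^ 2)
      nlinarith
    · have h1 : Real.exp s ≤ Real.exp (s ^ 2) := Real.exp_le_exp.2 (by nlinarith)
      linarith

theorem sum_mul_exp_pos (hp : ∀ i, 0 ≤ p i) (hp1 : ∑ i, p i = 1) (t : ι → ℝ) :
    0 < ∑ i, p i * Real.exp (t i) := by
  have h := (convexOn_exp.map_sum_le (t := Finset.univ) (w := p) (p := t)
    (fun i _ => hp i) hp1 (fun i _ => Set.mem_univ _))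
  simp only [smul_eq_mul] at h
  exact (Real.exp_pos _).trans_le h

theorem sum_mul_le_log_sum_mul_exp (hp : ∀ i, 0 ≤ p i) (hp1 : ∑ i, p i = 1) (t : ι → ℝ) :
    ∑ i, p i * t i ≤ Real.log (∑ i, p i * Real.exp (t i)) := by
  have h := (convexOn_exp.map_sum_le (t := Finset.univ) (w := p) (p := t)
    (fun i _ => hp i) hp1 (fun i _ => Set.mem_univ _))
  simp only [smul_eq_mul] at h
  exact (Real.le_log_iff_exp_le (sum_mul_exp_pos hp hp1 t)).2 h

theorem sum_mul_lt_log_sum_mul_exp (hp : ∀ i, 0 < p i) (hp1 : ∑ i, p i = 1) {i j : ι}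
    (hij : t i ≠ t j) :
    ∑ i, p i * t i < Real.log (∑ i, p i * Real.exp (t i)) := by
  have h := (strictConvexOn_exp.map_sum_lt (t := Finset.univ) (w := p) (p := t)
    (fun i _ => hp i) hp1 (fun i _ => Set.mem_univ _) ⟨i, Finset.mem_univ _, j, Finset.mem_univ _, hij⟩)
  simp only [smul_eq_mul] at h
  exact (Real.lt_log_iff_exp_lt (sum_mul_exp_pos (fun i => (hp i).le) hp1 t)).2 h

theorem log_sum_mul_exp_le (hp : ∀ i, 0 ≤ p i) (hp1 : ∑ i, p i = 1) {M : ℝ}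
    (hM : ∀ i, |t i| ≤ M) :
    Real.log (∑ i, p i * Real.exp (t i)) ≤ ∑ i, p i * t i + (2 * M) ^ 2 := by
  set m := ∑ i, p i * t i with hm
  have hmM : |m| ≤ M := by
    calc |m| ≤ ∑ i, |p i * t i| := Finset.abs_sum_le_sum_abs _ _
      _ ≤ ∑ i, p i * M := Finset.sum_le_sum fun i _ => by
          rw [abs_mul, abs_of_nonneg (hp i)]
          exact mul_le_mul_of_nonneg_left (hM i) (hp i)
      _ = M := by rw [← Finset.sum_mul, hp1, one_mul]
  -- Both `t i` and its mean lie in `[-M, M]`, so centring costs the factor 2.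
  have hs : ∀ i, (t i - m) ^ 2 ≤ (2 * M) ^ 2 := fun i => by
    have h1 := abs_le.1 hmM
    have h2 := abs_le.1 (hM i)
    exact sq_le_sq' (by linarith) (by linarith)
  rw [Real.log_le_iff_le_exp (sum_mul_exp_pos hp hp1 t), Real.exp_add]
  calc ∑ i, p i * Real.exp (t i)
      = ∑ i, Real.exp m * (p i * Real.exp (t i - m)) := Finset.sum_congr rfl fun i _ => by
        rw [mul_left_comm, ← Real.exp_add]; ring_nf
    _ = Real.exp m * ∑ i, p i * Real.exp (t i - m) := by rw [Finset.mul_sum]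
    _ ≤ Real.exp m * ∑ i, (p i * (t i - m) + p i * Real.exp ((2 * M) ^ 2)) := by
        gcongr with i
        rw [← mul_add]
        exact mul_le_mul_of_nonneg_left ((exp_le_add_exp_sq _).trans
          (add_le_add le_rfl (Real.exp_le_exp.2 (hs i)))) (hp i)
    _ = Real.exp m * Real.exp ((2 * M) ^ 2) := by
        simp only [Finset.sum_add_distrib, mul_sub, Finset.sum_sub_distrib, ← Finset.sum_mul, hp1]
        rw [← hm]; ring

end LogSumExp

/-! ### Convexity, smoothness and gradient of `h` for fixed `x`. -/

section Pointwise

variable {J : ℕ} {𝒳 𝒴 : Type*} {ε : ℝ} {ν : Fin J → ℝ} {y : Fin J → 𝒴} {c : 𝒳 → 𝒴 → ℝ}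

/-- The normalizing sum inside the logarithm of `h`. -/
def partition (ε : ℝ) (ν : Fin J → ℝ) (y : Fin J → 𝒴) (c : 𝒳 → 𝒴 → ℝ)
    (x : 𝒳) (v : EuclideanSpace ℝ (Fin J)) : ℝ :=
  ∑ j, Real.exp ((v j - c x (y j)) / ε) * ν j

/-- The conditional law of the target point given `x` for the dual vector `v`. -/
def weight (ε : ℝ) (ν : Fin J → ℝ) (y : Fin J → 𝒴) (c : 𝒳 → 𝒴 → ℝ)
    (x : 𝒳) (v : EuclideanSpace ℝ (Fin J)) (j : Fin J) : ℝ :=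
  Real.exp ((v j - c x (y j)) / ε) * ν j / partition ε ν y c x v

theorem nonempty_of_sum_eq_one (hν_sum : ∑ j, ν j = 1) : Nonempty (Fin J) := by
  by_contra h
  rw [not_nonempty_iff] at h
  simp at hν_sum

theorem partition_pos (hν : ∀ j, 0 < ν j) (hν_sum : ∑ j, ν j = 1) (x : 𝒳)
    (v : EuclideanSpace ℝ (Fin J)) : 0 < partition ε ν y c x v := by
  have := nonempty_of_sum_eq_one hν_sum
  exact Finset.sum_pos (fun j _ => mul_pos (Real.exp_pos _) (hν j)) Finset.univ_nonempty

theorem weight_pos (hν : ∀ j, 0 < ν j) (hν_sum : ∑ j, ν j = 1) (x : 𝒳)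
    (v : EuclideanSpace ℝ (Fin J)) (j : Fin J) : 0 < weight ε ν y c x v j :=
  div_pos (mul_pos (Real.exp_pos _) (hν j)) (partition_pos hν hν_sum x v)

theorem sum_weight (hν : ∀ j, 0 < ν j) (hν_sum : ∑ j, ν j = 1) (x : 𝒳)
    (v : EuclideanSpace ℝ (Fin J)) : ∑ j, weight ε ν y c x v j = 1 := by
  simp only [weight, ← Finset.sum_div]
  exact div_self (partition_pos hν hν_sum x v).ne'

theorem weight_le_one (hν : ∀ j, 0 < ν j) (hν_sum : ∑ j, ν j = 1) (x : 𝒳)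
    (v : EuclideanSpace ℝ (Fin J)) (j : Fin J) : weight ε ν y c x v j ≤ 1 := by
  rw [← sum_weight (ε := ε) (y := y) (c := c) hν hν_sum x v]
  exact Finset.single_le_sum (fun i _ => (weight_pos hν hν_sum x v i).le) (Finset.mem_univ j)

/-- Change of base point: moving from `v` to `w` multiplies the normalizing sum by an exponential
moment under the weights at `v`. This is what turns remainders of `h` into Jensen gaps. -/
theorem partition_eq_mul (hν : ∀ j, 0 < ν j) (hν_sum : ∑ j, ν j = 1) (x : 𝒳)
    (v w : EuclideanSpace ℝ (Fin J)) :
    partition ε ν y c x w = partition ε ν y c x v *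
      ∑ j, weight ε ν y c x v j * Real.exp ((w j - v j) / ε) := by
  rw [Finset.mul_sum, partition]
  refine Finset.sum_congr rfl fun j _ => ?_
  have hne := (partition_pos (ε := ε) (y := y) (c := c) hν hν_sum x v).ne'
  rw [weight, ← mul_assoc, mul_div_cancel₀ _ hne, mul_right_comm, ← Real.exp_add]
  congr 2
  ring

/-- The explicit formula for the gradient of `h`. -/
def grad (ε : ℝ) (ν : Fin J → ℝ) (y : Fin J → 𝒴) (c : 𝒳 → 𝒴 → ℝ)
    (x : 𝒳) (v : EuclideanSpace ℝ (Fin J)) : EuclideanSpace ℝ (Fin J) :=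
  WithLp.toLp 2 fun j => weight ε ν y c x v j - ν j

theorem inner_eq_sum (u v : EuclideanSpace ℝ (Fin J)) : inner ℝ u v = ∑ j, u j * v j := by
  rw [PiLp.inner_apply]
  exact Finset.sum_congr rfl fun j _ => by simp [mul_comm]

theorem h_sub_eq (hε : 0 < ε) (hν : ∀ j, 0 < ν j) (hν_sum : ∑ j, ν j = 1) (x : 𝒳)
    (v w : EuclideanSpace ℝ (Fin J)) :
    h ε ν y c x w - h ε ν y c x v - inner ℝ (grad ε ν y c x v) (w - v) =
      ε * (Real.log (∑ j, weight ε ν y c x v j * Real.exp ((w j - v j) / ε)) -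
        ∑ j, weight ε ν y c x v j * ((w j - v j) / ε)) := by
  have hw : ∀ u, h ε ν y c x u = ε + ε * Real.log (partition ε ν y c x u) - ∑ j, u j * ν j :=
    fun u => rfl
  have hsum := sum_mul_exp_pos (fun j => (weight_pos (ε := ε) (y := y) (c := c) hν hν_sum x v j).le)
    (sum_weight hν hν_sum x v) fun j => (w j - v j) / ε
  rw [hw, hw, partition_eq_mul hν hν_sum x v w,
    Real.log_mul (partition_pos hν hν_sum x v).ne' hsum.ne', inner_eq_sum, mul_sub, Finset.mul_sum]
  have e1 : ∀ j, ε * (weight ε ν y c x v j * ((w j - v j) / ε)) =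
      weight ε ν y c x v j * (w j - v j) := fun j => by field_simp
  simp only [e1, grad, PiLp.sub_apply, sub_mul, mul_sub, Finset.sum_sub_distrib]
  simp only [mul_comm (ν _)]
  ring

theorem h_ge_linear (hε : 0 < ε) (hν : ∀ j, 0 < ν j) (hν_sum : ∑ j, ν j = 1) (x : 𝒳)
    (v w : EuclideanSpace ℝ (Fin J)) :
    h ε ν y c x v + inner ℝ (grad ε ν y c x v) (w - v) ≤ h ε ν y c x w := by
  have h1 := h_sub_eq (y := y) (c := c) hε hν hν_sum x v w
  have h2 := sum_mul_le_log_sum_mul_exp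
    (fun j => (weight_pos (ε := ε) (y := y) (c := c) hν hν_sum x v j).le)
    (sum_weight hν hν_sum x v) fun j => (w j - v j) / ε
  have h3 := mul_nonneg hε.le (sub_nonneg.2 h2)
  linarith

theorem h_gt_linear (hε : 0 < ε) (hν : ∀ j, 0 < ν j) (hν_sum : ∑ j, ν j = 1) (x : 𝒳)
    {v w : EuclideanSpace ℝ (Fin J)} {i j : Fin J} (hij : w i - v i ≠ w j - v j) :
    h ε ν y c x v + inner ℝ (grad ε ν y c x v) (w - v) < h ε ν y c x w := by
  have h1 := h_sub_eq (y := y) (c := c) hε hν hν_sum x v w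
  have h2 := sum_mul_lt_log_sum_mul_exp (t := fun j => (w j - v j) / ε) (i := i) (j := j)
    (fun j => (weight_pos (ε := ε) (y := y) (c := c) hν hν_sum x v j))
    (sum_weight hν hν_sum x v) (fun h => hij ((div_left_inj' hε.ne').1 h))
  have h3 := mul_pos hε (sub_pos.2 h2)
  linarith

theorem h_le_quadratic (hε : 0 < ε) (hν : ∀ j, 0 < ν j) (hν_sum : ∑ j, ν j = 1) (x : 𝒳)
    (v w : EuclideanSpace ℝ (Fin J)) :
    h ε ν y c x w ≤ h ε ν y c x v + inner ℝ (grad ε ν y c x v) (w - v) +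
      4 / ε * ‖w - v‖ ^ 2 := by
  have h1 := h_sub_eq (y := y) (c := c) hε hν hν_sum x v w
  have h2 := log_sum_mul_exp_le (t := fun j => (w j - v j) / ε) (M := ‖w - v‖ / ε)
    (fun j => (weight_pos (ε := ε) (y := y) (c := c) hν hν_sum x v j).le)
    (sum_weight hν hν_sum x v) (fun j => by
      rw [abs_div, abs_of_pos hε]
      exact div_le_div_of_nonneg_right (PiLp.norm_apply_le (w - v) j) hε.le)
  have h3 := mul_le_mul_of_nonneg_left (sub_le_iff_le_add'.2 h2) hε.le
  have h4 : ε * (2 * (‖w - v‖ / ε)) ^ 2 = 4 / ε * ‖w - v‖ ^ 2 := by field_simp; ring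
  linarith

/-- The remainder is squeezed between 0 and a quadratic, so no differentiation of the logarithm is
needed. -/
theorem hasGradientAt_h (hε : 0 < ε) (hν : ∀ j, 0 < ν j) (hν_sum : ∑ j, ν j = 1) (x : 𝒳)
    (v : EuclideanSpace ℝ (Fin J)) :
    HasGradientAt (fun w => h ε ν y c x w) (grad ε ν y c x v) v := by
  rw [hasGradientAt_iff_isLittleO]
  have h1 : (fun w => h ε ν y c x w - h ε ν y c x v - inner ℝ (grad ε ν y c x v) (w - v)) =O[𝓝 v]
      fun w => ‖w - v‖ ^ 2 := by
    refine Asymptotics.IsBigO.of_bound (4 / ε) (Eventually.of_forall fun w => ?_)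
    have h1 := h_ge_linear (y := y) (c := c) hε hν hν_sum x v w
    have h2 := h_le_quadratic (y := y) (c := c) hε hν hν_sum x v w
    rw [Real.norm_of_nonneg (by linarith), Real.norm_of_nonneg (by positivity)]
    linarith
  refine h1.trans_isLittleO ?_
  have h2 : Tendsto (fun w => w - v) (𝓝 v) (𝓝 0) := by
    have : Continuous fun w => w - v := by fun_prop
    simpa using this.tendsto v
  exact ((Asymptotics.isLittleO_norm_pow_id (E' := EuclideanSpace ℝ (Fin J)) one_lt_two).comp_tendsto h2)

theorem gradh_eq_grad (hε : 0 < ε) (hν : ∀ j, 0 < ν j) (hν_sum : ∑ j, ν j = 1) (x : 𝒳)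
    (v : EuclideanSpace ℝ (Fin J)) : gradh ε ν y c x v = grad ε ν y c x v :=
  (hasGradientAt_h hε hν hν_sum x v).gradient

theorem norm_toLp_le_one {p : Fin J → ℝ} (hp : ∀ i, 0 ≤ p i) (hp1 : ∑ i, p i = 1) :
    ‖(WithLp.toLp 2 p : EuclideanSpace ℝ (Fin J))‖ ≤ 1 := by
  rw [← sq_le_one_iff₀ (norm_nonneg _), EuclideanSpace.norm_sq_eq, ← hp1]
  refine Finset.sum_le_sum fun i _ => ?_
  have h1 : p i ≤ 1 := hp1 ▸ Finset.single_le_sum (fun i _ => hp i) (Finset.mem_univ i)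
  rw [Real.norm_eq_abs, sq_abs]
  change p i ^ 2 ≤ p i
  nlinarith [hp i]

theorem norm_grad_le (hν : ∀ j, 0 < ν j) (hν_sum : ∑ j, ν j = 1) (x : 𝒳)
    (v : EuclideanSpace ℝ (Fin J)) : ‖grad ε ν y c x v‖ ≤ 2 := by
  have h1 : grad ε ν y c x v = WithLp.toLp 2 (weight ε ν y c x v) - WithLp.toLp 2 ν := rfl
  rw [h1]
  refine (norm_sub_le _ _).trans ?_
  have h2 := norm_toLp_le_one (fun j => (weight_pos (ε := ε) (y := y) (c := c) hν hν_sum x v j).le)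
    (sum_weight hν hν_sum x v)
  have h3 := norm_toLp_le_one (fun j => (hν j).le) hν_sum
  linarith

/-- The numerator grows by a factor at most `e^δ` and the denominator shrinks by at most `e^(-δ)`.
The point is that the modulus of continuity does not depend on `x`. -/
theorem abs_weight_sub_le (hε : 0 < ε) (hν : ∀ j, 0 < ν j) (hν_sum : ∑ j, ν j = 1) (x : 𝒳)
    (v w : EuclideanSpace ℝ (Fin J)) (j : Fin J) :
    |weight ε ν y c x w j - weight ε ν y c x v j| ≤ Real.exp (2 * (‖w - v‖ / ε)) - 1 := by
  have key : ∀ v w : EuclideanSpace ℝ (Fin J), weight ε ν y c x w j - weight ε ν y c x v j ≤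
      Real.exp (2 * (‖w - v‖ / ε)) - 1 := by
    intro v w
    set δ := ‖w - v‖ / ε with hδ
    have hδ0 : 0 ≤ δ := by positivity
    have ht : ∀ j, |(w j - v j) / ε| ≤ δ := fun j => by
      rw [abs_div, abs_of_pos hε]
      exact div_le_div_of_nonneg_right (PiLp.norm_apply_le (w - v) j) hε.le
    have hle : weight ε ν y c x w j ≤ weight ε ν y c x v j * Real.exp (2 * δ) := by
      have hpv := partition_pos (ε := ε) (y := y) (c := c) hν hν_sum x v
      have hpw := partition_pos (ε := ε) (y := y) (c := c) hν hν_sum x w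
      have hpart : partition ε ν y c x v * Real.exp (-δ) ≤ partition ε ν y c x w := by
        rw [partition_eq_mul hν hν_sum x v w]
        refine mul_le_mul_of_nonneg_left ?_ hpv.le
        calc Real.exp (-δ) = ∑ j, weight ε ν y c x v j * Real.exp (-δ) := by
              rw [← Finset.sum_mul, sum_weight hν hν_sum, one_mul]
          _ ≤ _ := Finset.sum_le_sum fun j _ => mul_le_mul_of_nonneg_left
              (Real.exp_le_exp.2 (abs_le.1 (ht j)).1) (weight_pos hν hν_sum x v j).le
      have hnum : Real.exp ((w j - c x (y j)) / ε) * ν j ≤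
          Real.exp ((v j - c x (y j)) / ε) * ν j * Real.exp δ := by
        rw [mul_right_comm, ← Real.exp_add]
        refine mul_le_mul_of_nonneg_right (Real.exp_le_exp.2 ?_) (hν j).le
        have e : (w j - c x (y j)) / ε = (v j - c x (y j)) / ε + (w j - v j) / ε := by ring
        rw [e]
        linarith [(abs_le.1 (ht j)).2]
      calc weight ε ν y c x w j
          ≤ Real.exp ((v j - c x (y j)) / ε) * ν j * Real.exp δ /
            (partition ε ν y c x v * Real.exp (-δ)) := by
            rw [weight]
            exact div_le_div₀ (mul_nonneg (mul_nonneg (Real.exp_pos _).le (hν j).le)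
              (Real.exp_pos _).le) hnum (mul_pos hpv (Real.exp_pos _)) hpart
        _ = _ := by
            rw [weight, Real.exp_neg, two_mul, Real.exp_add]
            field_simp
    have h1 := weight_le_one (ε := ε) (y := y) (c := c) hν hν_sum x v j
    have h2 := (weight_pos (ε := ε) (y := y) (c := c) hν hν_sum x v j)
    have h3 : 1 ≤ Real.exp (2 * δ) := Real.one_le_exp (by linarith)
    nlinarith
  rw [abs_le]
  refine ⟨?_, key v w⟩
  have := key w v
  rw [norm_sub_rev] at this
  linarith

/-- For a constant increment the Jensen gap is zero, and the gradient, a difference of two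
probability vectors, is orthogonal to constants. -/
theorem h_add_const (hε : 0 < ε) (hν : ∀ j, 0 < ν j) (hν_sum : ∑ j, ν j = 1) (x : 𝒳)
    {v w : EuclideanSpace ℝ (Fin J)} {a : ℝ} (ha : ∀ j, w j = v j + a) :
    h ε ν y c x w = h ε ν y c x v := by
  have h1 := h_sub_eq (y := y) (c := c) hε hν hν_sum x v w
  have h2 : inner ℝ (grad ε ν y c x v) (w - v) = 0 := by
    simp only [inner_eq_sum, PiLp.sub_apply, ha, add_sub_cancel_left, ← Finset.sum_mul, grad,
      Finset.sum_sub_distrib, sum_weight hν hν_sum x v, hν_sum, sub_self, zero_mul]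
  simp only [ha, add_sub_cancel_left, ← Finset.sum_mul, sum_weight hν hν_sum x v, one_mul,
    Real.log_exp, sub_self, mul_zero, h2, sub_zero] at h1
  linarith

end Pointwise

/-! ### The objective `H`: convexity, uniqueness of the minimizer, growth. -/

section Objective

variable {J : ℕ} {𝒳 𝒴 : Type*} [MeasurableSpace 𝒳] {μ : Measure 𝒳}
  {ε : ℝ} {ν : Fin J → ℝ} {y : Fin J → 𝒴} {c : 𝒳 → 𝒴 → ℝ}

theorem measurable_weight (hc : ∀ j, Measurable fun x => c x (y j)) {Ω : Type*}
    {m : MeasurableSpace Ω} {ξ : Ω → 𝒳} {v : Ω → EuclideanSpace ℝ (Fin J)} (hξ : Measurable ξ)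
    (hv : Measurable v) (j : Fin J) :
    Measurable fun ω => weight ε ν y c (ξ ω) (v ω) j := by
  have h1 : ∀ j, Measurable fun ω => Real.exp ((v ω j - c (ξ ω) (y j)) / ε) * ν j := fun j => by
    have h2 : Measurable fun ω => v ω j :=
      (EuclideanSpace.proj (𝕜 := ℝ) j).continuous.measurable.comp hv
    have h3 : Measurable fun ω => c (ξ ω) (y j) := (hc j).comp hξ
    fun_prop
  exact (h1 j).div (Finset.measurable_fun_sum _ fun i _ => h1 i)

theorem measurable_grad (hc : ∀ j, Measurable fun x => c x (y j)) {Ω : Type*}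
    {m : MeasurableSpace Ω} {ξ : Ω → 𝒳} {v : Ω → EuclideanSpace ℝ (Fin J)} (hξ : Measurable ξ)
    (hv : Measurable v) : Measurable fun ω => grad ε ν y c (ξ ω) (v ω) :=
  (WithLp.measurable_toLp 2 _).comp
    (measurable_pi_lambda _ fun j => (measurable_weight hc hξ hv j).sub_const (ν j))

theorem integrable_grad [IsFiniteMeasure μ] (hν : ∀ j, 0 < ν j) (hν_sum : ∑ j, ν j = 1)
    (hc : ∀ j, Measurable fun x => c x (y j)) (v : EuclideanSpace ℝ (Fin J)) :
    Integrable (fun x => grad ε ν y c x v) μ :=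
  Integrable.of_bound (measurable_grad hc measurable_id measurable_const).aestronglyMeasurable 2
    (Eventually.of_forall fun x => norm_grad_le hν hν_sum x v)

/-- The logarithm is bounded below by Jensen, by an affine function of the costs, and above by a
constant after dropping `c ≥ 0`. -/
theorem integrable_h [IsFiniteMeasure μ] (hε : 0 < ε) (hν : ∀ j, 0 < ν j) (hν_sum : ∑ j, ν j = 1)
    (hc : ∀ j, Measurable fun x => c x (y j)) (hci : ∀ j, Integrable (fun x => c x (y j)) μ)
    (hc0 : ∀ x z, 0 ≤ c x z) (v : EuclideanSpace ℝ (Fin J)) :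
    Integrable (fun x => h ε ν y c x v) μ := by
  unfold h
  refine ((integrable_const ε).add (Integrable.const_mul ?_ ε)).sub (integrable_const _)
  have hm : Measurable fun x => Real.log (∑ j, Real.exp ((v j - c x (y j)) / ε) * ν j) :=
    Real.measurable_log.comp (Finset.measurable_sum _ fun j _ =>
      (Real.measurable_exp.comp ((measurable_const.sub (hc j)).div_const ε)).mul_const _)
  have hlow : Integrable (fun x => ∑ j, ν j * ((v j - c x (y j)) / ε)) μ :=
    integrable_finsetSum _ fun j _ =>
      (((integrable_const (v j)).sub (hci j)).div_const ε).const_mul (ν j)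
  refine integrable_of_le_of_le hm.aestronglyMeasurable
    (g₂ := fun _ => Real.log (∑ j, Real.exp (v j / ε) * ν j))
    (Eventually.of_forall fun x => ?_) (Eventually.of_forall fun x => ?_) hlow (integrable_const _)
  · simp only [mul_comm _ (ν _)]
    exact sum_mul_le_log_sum_mul_exp (fun j => (hν j).le) hν_sum _
  · refine Real.log_le_log (partition_pos hν hν_sum x v) (Finset.sum_le_sum fun j _ => ?_)
    refine mul_le_mul_of_nonneg_right (Real.exp_le_exp.2 ?_) (hν j).le
    exact div_le_div_of_nonneg_right (by linarith [hc0 x (y j)]) hε.le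

/-- The gradient of the objective `H`. -/
def meanGrad (ε : ℝ) (ν : Fin J → ℝ) (y : Fin J → 𝒴) (c : 𝒳 → 𝒴 → ℝ) (μ : Measure 𝒳)
    (v : EuclideanSpace ℝ (Fin J)) : EuclideanSpace ℝ (Fin J) :=
  ∫ x, grad ε ν y c x v ∂μ

theorem measurable_meanGrad [IsProbabilityMeasure μ] (hc : ∀ j, Measurable fun x => c x (y j)) :
    Measurable (meanGrad ε ν y c μ) := by
  have h1 : Measurable fun q : EuclideanSpace ℝ (Fin J) × 𝒳 => grad ε ν y c q.2 q.1 :=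
    measurable_grad hc measurable_snd measurable_fst
  exact (h1.stronglyMeasurable.integral_prod_right (ν := μ)).measurable

theorem norm_meanGrad_le [IsProbabilityMeasure μ] (hν : ∀ j, 0 < ν j) (hν_sum : ∑ j, ν j = 1)
    (v : EuclideanSpace ℝ (Fin J)) : ‖meanGrad ε ν y c μ v‖ ≤ 2 := by
  have := norm_integral_le_of_norm_le_const (μ := μ) (f := fun x => grad ε ν y c x v) (C := 2)
    (Eventually.of_forall fun x => norm_grad_le hν hν_sum x v)
  simpa [meanGrad] using this

theorem integral_linear [IsProbabilityMeasure μ] (hε : 0 < ε) (hν : ∀ j, 0 < ν j)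
    (hν_sum : ∑ j, ν j = 1)
    (hc : ∀ j, Measurable fun x => c x (y j)) (hci : ∀ j, Integrable (fun x => c x (y j)) μ)
    (hc0 : ∀ x z, 0 ≤ c x z) (v w : EuclideanSpace ℝ (Fin J)) :
    Integrable (fun x => h ε ν y c x v + inner ℝ (grad ε ν y c x v) w) μ ∧
    ∫ x, (h ε ν y c x v + inner ℝ (grad ε ν y c x v) w) ∂μ =
      H ε ν y c μ v + inner ℝ (meanGrad ε ν y c μ v) w := by
  have h1 := integrable_h (μ := μ) hε hν hν_sum hc hci hc0 v
  have h2 := integrable_grad (μ := μ) (ε := ε) hν hν_sum hc v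
  have h3 : Integrable (fun x => inner ℝ (grad ε ν y c x v) w) μ := h2.inner_const w
  refine ⟨h1.add h3, ?_⟩
  rw [integral_add h1 h3]
  congr 1
  simp only [real_inner_comm w]
  exact integral_inner h2 w

theorem H_ge_linear [IsProbabilityMeasure μ] (hε : 0 < ε) (hν : ∀ j, 0 < ν j)
    (hν_sum : ∑ j, ν j = 1)
    (hc : ∀ j, Measurable fun x => c x (y j)) (hci : ∀ j, Integrable (fun x => c x (y j)) μ)
    (hc0 : ∀ x z, 0 ≤ c x z) (v w : EuclideanSpace ℝ (Fin J)) :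
    H ε ν y c μ v + inner ℝ (meanGrad ε ν y c μ v) (w - v) ≤ H ε ν y c μ w := by
  obtain ⟨h1, h2⟩ := integral_linear (μ := μ) hε hν hν_sum hc hci hc0 v (w - v)
  rw [← h2]
  exact integral_mono h1 (integrable_h hε hν hν_sum hc hci hc0 w) fun x =>
    h_ge_linear hε hν hν_sum x v w

theorem H_gt_linear [IsProbabilityMeasure μ] (hε : 0 < ε) (hν : ∀ j, 0 < ν j)
    (hν_sum : ∑ j, ν j = 1)
    (hc : ∀ j, Measurable fun x => c x (y j)) (hci : ∀ j, Integrable (fun x => c x (y j)) μ)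
    (hc0 : ∀ x z, 0 ≤ c x z) {v w : EuclideanSpace ℝ (Fin J)} {i j : Fin J}
    (hij : w i - v i ≠ w j - v j) :
    H ε ν y c μ v + inner ℝ (meanGrad ε ν y c μ v) (w - v) < H ε ν y c μ w := by
  obtain ⟨h1, h2⟩ := integral_linear (μ := μ) hε hν hν_sum hc hci hc0 v (w - v)
  rw [← h2, H, ← sub_pos, ← integral_sub (integrable_h hε hν hν_sum hc hci hc0 w) h1]
  have hpos : ∀ x, 0 < h ε ν y c x w - (h ε ν y c x v + inner ℝ (grad ε ν y c x v) (w - v)) :=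
    fun x => sub_pos.2 (h_gt_linear hε hν hν_sum x hij)
  rw [integral_pos_iff_support_of_nonneg (fun x => (hpos x).le)
    ((integrable_h hε hν hν_sum hc hci hc0 w).sub h1)]
  rw [Function.support_eq_univ fun x => (hpos x).ne']
  simp

theorem H_le_quadratic [IsProbabilityMeasure μ] (hε : 0 < ε) (hν : ∀ j, 0 < ν j)
    (hν_sum : ∑ j, ν j = 1)
    (hc : ∀ j, Measurable fun x => c x (y j)) (hci : ∀ j, Integrable (fun x => c x (y j)) μ)
    (hc0 : ∀ x z, 0 ≤ c x z) (v w : EuclideanSpace ℝ (Fin J)) :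
    H ε ν y c μ w ≤ H ε ν y c μ v + inner ℝ (meanGrad ε ν y c μ v) (w - v) +
      4 / ε * ‖w - v‖ ^ 2 := by
  obtain ⟨h1, h2⟩ := integral_linear (μ := μ) hε hν hν_sum hc hci hc0 v (w - v)
  have h3 := integral_mono (integrable_h hε hν hν_sum hc hci hc0 w)
    (h1.add (integrable_const (4 / ε * ‖w - v‖ ^ 2))) fun x =>
      h_le_quadratic hε hν hν_sum x v w
  simp only [Pi.add_apply] at h3
  rw [integral_add h1 (integrable_const _), h2] at h3
  simpa [H] using h3

theorem H_add_const (hε : 0 < ε) (hν : ∀ j, 0 < ν j) (hν_sum : ∑ j, ν j = 1)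
    {v w : EuclideanSpace ℝ (Fin J)} {a : ℝ} (ha : ∀ j, w j = v j + a) :
    H ε ν y c μ w = H ε ν y c μ v :=
  integral_congr_ae (Eventually.of_forall fun x => h_add_const hε hν hν_sum x ha)

theorem continuous_H [IsProbabilityMeasure μ] (hε : 0 < ε) (hν : ∀ j, 0 < ν j)
    (hν_sum : ∑ j, ν j = 1)
    (hc : ∀ j, Measurable fun x => c x (y j)) (hci : ∀ j, Integrable (fun x => c x (y j)) μ)
    (hc0 : ∀ x z, 0 ≤ c x z) : Continuous (H ε ν y c μ) := by
  rw [continuous_iff_continuousAt]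
  intro v
  have hl : Continuous fun w => H ε ν y c μ v + inner ℝ (meanGrad ε ν y c μ v) (w - v) := by
    fun_prop
  have hu : Continuous fun w => H ε ν y c μ v + inner ℝ (meanGrad ε ν y c μ v) (w - v) +
      4 / ε * ‖w - v‖ ^ 2 := by fun_prop
  refine tendsto_of_tendsto_of_tendsto_of_le_of_le (by simpa using hl.tendsto v)
    (by simpa using hu.tendsto v) (H_ge_linear hε hν hν_sum hc hci hc0 v)
    (H_le_quadratic hε hν hν_sum hc hci hc0 v)

theorem meanGrad_eq_zero [IsProbabilityMeasure μ] (hε : 0 < ε) (hν : ∀ j, 0 < ν j)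
    (hν_sum : ∑ j, ν j = 1)
    (hc : ∀ j, Measurable fun x => c x (y j)) (hci : ∀ j, Integrable (fun x => c x (y j)) μ)
    (hc0 : ∀ x z, 0 ≤ c x z) {v : EuclideanSpace ℝ (Fin J)}
    (hmin : ∀ w, H ε ν y c μ v ≤ H ε ν y c μ w) : meanGrad ε ν y c μ v = 0 := by
  set g := meanGrad ε ν y c μ v with hg
  -- The step `ε / 8` minimizes the quadratic upper bound along `-g`; it would lower `H` by at least
  -- `ε / 16 * ‖g‖ ^ 2`.
  have h1 := H_le_quadratic (μ := μ) hε hν hν_sum hc hci hc0 v (v - (ε / 8) • g)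
  have h2 := hmin (v - (ε / 8) • g)
  have e : v - (ε / 8) • g - v = -((ε / 8) • g) := by abel
  rw [e, inner_neg_right, inner_smul_right, norm_neg, norm_smul, ← hg, real_inner_self_eq_norm_sq,
    Real.norm_of_nonneg (by positivity)] at h1
  have h3 : 4 / ε * (ε / 8 * ‖g‖) ^ 2 = ε / 16 * ‖g‖ ^ 2 := by field_simp; ring
  have h4 : ‖g‖ ^ 2 ≤ 0 := by
    rw [h3] at h1
    by_contra hcon
    push Not at hcon
    have := mul_pos hε hcon
    linarith
  exact norm_eq_zero.1 (pow_eq_zero_iff two_ne_zero |>.1 (le_antisymm h4 (sq_nonneg _)))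

theorem mem_orthogonal_vJ_iff (hJ : 0 < J) (v : EuclideanSpace ℝ (Fin J)) :
    v ∈ (Submodule.span ℝ {vJ J})ᗮ ↔ ∑ j, v j = 0 := by
  rw [Submodule.mem_orthogonal_singleton_iff_inner_right, inner_eq_sum]
  have h1 : (1 / Real.sqrt J) ≠ 0 := by positivity
  have h2 : ∑ j, vJ J j * v j = 1 / Real.sqrt J * ∑ j, v j := by rw [Finset.mul_sum]; rfl
  rw [h2, mul_eq_zero]
  exact or_iff_right h1

theorem mulVec_PJ_apply (hJ : 0 < J) (v : Fin J → ℝ) (i : Fin J) :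
    (PJ J).mulVec v i = v i - (∑ j, v j) / J := by
  have h1 : Real.sqrt J * Real.sqrt J = J := Real.mul_self_sqrt (by positivity)
  have h2 : (0 : ℝ) < J := by exact_mod_cast hJ
  have h3 : (outer (vJ J)).mulVec v i = 1 / Real.sqrt J * (1 / Real.sqrt J) * ∑ j, v j := by
    rw [Finset.mul_sum]; rfl
  rw [PJ, Matrix.sub_mulVec, Matrix.one_mulVec, Pi.sub_apply, h3, div_mul_div_comm, h1]
  ring

theorem H_lt_of_ne [IsProbabilityMeasure μ] (hε : 0 < ε) (hν : ∀ j, 0 < ν j)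
    (hν_sum : ∑ j, ν j = 1)
    (hc : ∀ j, Measurable fun x => c x (y j)) (hci : ∀ j, Integrable (fun x => c x (y j)) μ)
    (hc0 : ∀ x z, 0 ≤ c x z) {v w : EuclideanSpace ℝ (Fin J)}
    (hmin : ∀ w, H ε ν y c μ v ≤ H ε ν y c μ w) (hv : ∑ j, v j = 0) (hw : ∑ j, w j = 0)
    (hne : w ≠ v) : H ε ν y c μ v < H ε ν y c μ w := by
  by_cases hconst : ∀ i j, w i - v i = w j - v j
  · exfalso
    apply hne
    have := nonempty_of_sum_eq_one hν_sum
    obtain ⟨i⟩ := this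
    have h1 : ∑ j, (w j - v j) = (J : ℝ) * (w i - v i) := by
      rw [Finset.sum_congr rfl fun j _ => hconst j i]
      simp [mul_sub]
    rw [Finset.sum_sub_distrib, hv, hw, sub_zero] at h1
    have h2 : (J : ℝ) ≠ 0 := by
      have := i.pos
      positivity
    have h3 : w i - v i = 0 := (mul_eq_zero.1 h1.symm).resolve_left h2
    ext j
    linarith [hconst j i]
  · push Not at hconst
    obtain ⟨i, j, hij⟩ := hconst
    have h1 := H_gt_linear (μ := μ) hε hν hν_sum hc hci hc0 hij
    rw [meanGrad_eq_zero hε hν hν_sum hc hci hc0 hmin, inner_zero_left, add_zero] at h1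
    exact h1

/-- Compactness gives a positive gap on the sphere of radius `r` among zero-sum vectors; convexity
along rays then makes the gap grow at least linearly beyond it. -/
theorem exists_growth [IsProbabilityMeasure μ] (hε : 0 < ε) (hν : ∀ j, 0 < ν j)
    (hν_sum : ∑ j, ν j = 1)
    (hc : ∀ j, Measurable fun x => c x (y j)) (hci : ∀ j, Integrable (fun x => c x (y j)) μ)
    (hc0 : ∀ x z, 0 ≤ c x z) {v : EuclideanSpace ℝ (Fin J)}
    (hmin : ∀ w, H ε ν y c μ v ≤ H ε ν y c μ w) (hv : ∑ j, v j = 0) {r : ℝ} (hr : 0 < r) :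
    ∃ m, 0 < m ∧ ∀ w : EuclideanSpace ℝ (Fin J), ∑ j, w j = 0 → r ≤ ‖w - v‖ →
      m * ‖w - v‖ ≤ H ε ν y c μ w - H ε ν y c μ v := by
  have hK : IsCompact (Metric.sphere v r ∩ {w : EuclideanSpace ℝ (Fin J) | ∑ j, w j = 0}) := by
    refine (isCompact_sphere v r).inter_right (isClosed_eq ?_ continuous_const)
    fun_prop
  obtain ⟨m, hm, hmK⟩ : ∃ m, 0 < m ∧ ∀ w : EuclideanSpace ℝ (Fin J), ∑ j, w j = 0 → ‖w - v‖ = r →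
      H ε ν y c μ v + m ≤ H ε ν y c μ w := by
    rcases (Metric.sphere v r ∩ {w : EuclideanSpace ℝ (Fin J) | ∑ j, w j = 0}).eq_empty_or_nonempty
      with he | hne
    -- For `J = 1` the only zero-sum vector is 0 and the sphere contributes nothing.
    · refine ⟨1, one_pos, fun w hw hwr => ?_⟩
      have : w ∈ (Metric.sphere v r ∩ {w : EuclideanSpace ℝ (Fin J) | ∑ j, w j = 0}) :=
        ⟨by rwa [mem_sphere_iff_norm], hw⟩
      rw [he] at this
      exact this.elim
    · obtain ⟨u, hu, humin⟩ := hK.exists_isMinOn hne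
        (continuous_H (μ := μ) hε hν hν_sum hc hci hc0).continuousOn
      have hur : ‖u - v‖ = r := by rw [← mem_sphere_iff_norm]; exact hu.1
      have hne : u ≠ v := by
        rintro rfl
        simp at hur
        exact hr.ne hur
      refine ⟨H ε ν y c μ u - H ε ν y c μ v,
        sub_pos.2 (H_lt_of_ne hε hν hν_sum hc hci hc0 hmin hv hu.2 hne), fun w hw hwr => ?_⟩
      have := humin (a := w) ⟨by rwa [mem_sphere_iff_norm], hw⟩
      simp only [Set.mem_ofPred_eq] at this
      linarith
  refine ⟨m / r, by positivity, fun w hw hwr => ?_⟩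
  set ρ := ‖w - v‖ with hρ
  have hρ0 : 0 < ρ := hr.trans_le hwr
  set t := r / ρ with ht
  have ht0 : 0 < t := by positivity
  set u := v + t • (w - v) with hu
  have hu1 : H ε ν y c μ v + m ≤ H ε ν y c μ u := by
    refine hmK u ?_ ?_
    · simp only [hu, PiLp.add_apply, PiLp.smul_apply, PiLp.sub_apply, smul_eq_mul,
        Finset.sum_add_distrib, ← Finset.mul_sum, Finset.sum_sub_distrib, hv, hw]
      simp
    · rw [hu, add_sub_cancel_left, norm_smul, Real.norm_of_nonneg ht0.le, ← hρ, ht]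
      field_simp
  have h1 := H_ge_linear (μ := μ) hε hν hν_sum hc hci hc0 u w
  have h2 := H_ge_linear (μ := μ) hε hν hν_sum hc hci hc0 u v
  have e1 : w - u = (1 - t) • (w - v) := by rw [hu, sub_smul, one_smul]; abel
  have e2 : v - u = (-t) • (w - v) := by rw [hu, neg_smul]; abel
  rw [e1, inner_smul_right] at h1
  rw [e2, inner_smul_right] at h2
  have ht1 : t ≤ 1 := (div_le_one hρ0).2 hwr
  set I := inner ℝ (meanGrad ε ν y c μ u) (w - v)
  -- The tangent inequalities at `u`, weighted by `t` and `1 - t`, cancel the inner product `I`.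
  have h3 : m ≤ t * (H ε ν y c μ w - H ε ν y c μ v) := by
    nlinarith [mul_le_mul_of_nonneg_left h1 ht0.le,
      mul_le_mul_of_nonneg_left h2 (sub_nonneg.2 ht1)]
  rw [ht] at h3
  calc m / r * ρ ≤ (r / ρ * (H ε ν y c μ w - H ε ν y c μ v)) / r * ρ := by gcongr
    _ = _ := by field_simp

end Objective

/-! ### Almost sure convergence of almost supermartingales. -/

section RobbinsSiegmund

variable {Ω : Type*} [mΩ : MeasurableSpace Ω] {P : Measure Ω}

/-- A lower bound makes the process bounded in L¹, since `|R| ≤ R + 2|B|` and the means do not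
increase; Doob's theorem applies to `-R`. -/
theorem ae_exists_tendsto_of_supermartingale [IsProbabilityMeasure P] {ℱ : Filtration ℕ mΩ}
    {R : ℕ → Ω → ℝ} (hR : Supermartingale R ℱ P) {B : ℝ} (hB : ∀ n ω, -B ≤ R n ω) :
    ∀ᵐ ω ∂P, ∃ l, Tendsto (fun n => R n ω) atTop (𝓝 l) := by
  have hB' : ∀ n ω, -|B| ≤ R n ω := fun n ω => (neg_le_neg (le_abs_self B)).trans (hB n ω)
  have hint : ∀ n, ∫ ω, R n ω ∂P ≤ ∫ ω, R 0 ω ∂P := fun n => by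
    have := hR.setIntegral_le (Nat.zero_le n) (MeasurableSet.univ)
    simpa using this
  have hL : ∀ n, eLpNorm ((-R) n) 1 P ≤ (Real.toNNReal (∫ ω, R 0 ω ∂P + 2 * |B|) : NNReal) := by
    intro n
    have hRi := hR.integrable n
    rw [eLpNorm_one_eq_lintegral_enorm]
    change ∫⁻ ω, ‖-R n ω‖ₑ ∂P ≤ ENNReal.ofReal _
    simp only [enorm_neg]
    rw [← ofReal_integral_norm_eq_lintegral_enorm hRi]
    refine ENNReal.ofReal_le_ofReal ?_
    calc ∫ ω, ‖R n ω‖ ∂P ≤ ∫ ω, (R n ω + 2 * |B|) ∂P := by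
          refine integral_mono hRi.norm (hRi.add (integrable_const _)) fun ω => ?_
          have h1 := hB' n ω
          have h2 := abs_nonneg B
          simp only [Real.norm_eq_abs]
          rw [abs_le]
          constructor <;> linarith
      _ = ∫ ω, R n ω ∂P + 2 * |B| := by rw [integral_add hRi (integrable_const _)]; simp
      _ ≤ _ := by linarith [hint n]
  filter_upwards [hR.neg.exists_ae_tendsto_of_bdd hL] with ω ⟨l, hl⟩
  exact ⟨-l, by simpa using hl.neg⟩

/-- A version of the Robbins–Siegmund theorem where the perturbation is deterministic. -/
theorem ae_tendsto_and_summable_of_setIntegral_le [IsProbabilityMeasure P] {ℱ : Filtration ℕ mΩ}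
    {Y D : ℕ → Ω → ℝ} {b : ℕ → ℝ} (hYm : StronglyAdapted ℱ Y) (hDm : StronglyAdapted ℱ D)
    (hYi : ∀ n, Integrable (Y n) P) (hDi : ∀ n, Integrable (D n) P)
    (hY0 : ∀ n ω, 0 ≤ Y n ω) (hD0 : ∀ n ω, 0 ≤ D n ω) (hb0 : ∀ n, 0 ≤ b n) (hb : Summable b)
    (hstep : ∀ n (A : Set Ω), MeasurableSet[ℱ n] A →
      ∫ ω in A, Y (n + 1) ω ∂P ≤ ∫ ω in A, (Y n ω - D n ω + b n) ∂P) :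
    ∀ᵐ ω ∂P, (∃ l, Tendsto (fun n => Y n ω) atTop (𝓝 l)) ∧ Summable fun n => D n ω := by
  -- Subtracting the partial sums of `b` gives a supermartingale both with and without the partial
  -- sums of `D` added. Both are bounded below by `-∑' k, b k`, so both converge, and their
  -- difference is exactly the partial sum of `D`.
  have hbs : ∀ n, ∑ k ∈ Finset.range n, b k ≤ ∑' k, b k := fun n =>
    hb.sum_le_tsum _ fun k _ => hb0 k
  have hDs : ∀ n ω, 0 ≤ ∑ k ∈ Finset.range n, D k ω := fun n ω =>
    Finset.sum_nonneg fun k _ => hD0 k ω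
  have hDsm : ∀ n m, n ≤ m + 1 →
      StronglyMeasurable[ℱ m] fun ω => ∑ k ∈ Finset.range n, D k ω := fun n m hnm =>
    Finset.stronglyMeasurable_fun_sum _ fun k hk =>
      (hDm k).mono (ℱ.mono (by have := Finset.mem_range.1 hk; omega))
  have hDsi : ∀ n, Integrable (fun ω => ∑ k ∈ Finset.range n, D k ω) P := fun n =>
    integrable_finsetSum _ fun k _ => hDi k
  have h1 : Supermartingale (fun n ω => Y n ω - ∑ k ∈ Finset.range n, b k) ℱ P := by
    refine supermartingale_of_setIntegral_succ_le
      (fun n => (hYm n).sub stronglyMeasurable_const)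
      (fun n => (hYi n).sub (integrable_const _)) fun n A hA => ?_
    have h2 := hstep n A hA
    have h3 : ∫ ω in A, (Y n ω - D n ω + b n) ∂P ≤ ∫ ω in A, (Y n ω + b n) ∂P :=
      setIntegral_mono (((hYi n).sub (hDi n)).add (integrable_const _)).integrableOn
        ((hYi n).add (integrable_const _)).integrableOn fun ω => by
          have := hD0 n ω
          simp only
          linarith
    rw [integral_sub (hYi _).integrableOn (integrable_const _),
      integral_sub (hYi _).integrableOn (integrable_const _)]
    rw [integral_add (hYi _).integrableOn (integrable_const _)] at h3
    simp only [integral_const, smul_eq_mul, Finset.sum_range_succ] at h3 ⊢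
    linarith
  have h2 : Supermartingale (fun n ω => Y n ω - ∑ k ∈ Finset.range n, b k +
      ∑ k ∈ Finset.range n, D k ω) ℱ P := by
    refine supermartingale_of_setIntegral_succ_le
      (fun n => ((hYm n).sub stronglyMeasurable_const).add (hDsm n n (by omega)))
      (fun n => ((hYi n).sub (integrable_const _)).add (hDsi n)) fun n A hA => ?_
    have h2 := hstep n A hA
    have e1 : ∀ n, ∫ ω in A, (Y n ω - ∑ k ∈ Finset.range n, b k +
        ∑ k ∈ Finset.range n, D k ω) ∂P = ∫ ω in A, Y n ω ∂P -
        ∫ _ω in A, ∑ k ∈ Finset.range n, b k ∂P + ∑ k ∈ Finset.range n, ∫ ω in A, D k ω ∂P := by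
      intro n
      have hi : Integrable (fun ω => Y n ω - ∑ k ∈ Finset.range n, b k) P :=
        (hYi n).sub (integrable_const _)
      rw [integral_add hi.integrableOn (hDsi n).integrableOn,
        integral_sub (hYi _).integrableOn (integrable_const _),
        integral_finsetSum _ fun k _ => (hDi k).integrableOn]
    have e2 : ∫ ω in A, (Y n ω - D n ω + b n) ∂P =
        ∫ ω in A, Y n ω ∂P - ∫ ω in A, D n ω ∂P + ∫ _ω in A, b n ∂P := by
      have hi : Integrable (fun ω => Y n ω - D n ω) P := (hYi n).sub (hDi n)
      rw [integral_add hi.integrableOn (integrable_const _),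
        integral_sub (hYi _).integrableOn (hDi _).integrableOn]
    rw [e1, e1, Finset.sum_range_succ, Finset.sum_range_succ]
    rw [e2] at h2
    simp only [integral_const, smul_eq_mul] at h2 ⊢
    linarith
  filter_upwards [ae_exists_tendsto_of_supermartingale h1 (B := ∑' k, b k) fun n ω => by
      linarith [hY0 n ω, hbs n],
    ae_exists_tendsto_of_supermartingale h2 (B := ∑' k, b k) fun n ω => by
      linarith [hY0 n ω, hbs n, hDs n ω]] with ω ⟨l₁, hl₁⟩ ⟨l₂, hl₂⟩
  refine ⟨⟨l₁ + ∑' k, b k, ?_⟩, ?_⟩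
  · simpa using hl₁.add hb.hasSum.tendsto_sum_nat
  · have h3 := hl₂.sub hl₁
    simp only [add_sub_cancel_left] at h3
    exact ((hasSum_iff_tendsto_nat_of_nonneg (fun n => hD0 n ω) _).2 h3).summable

end RobbinsSiegmund

/-! ### Quadratic form bounds for a matrix and its inverse. -/

section MatrixAction

variable {J : ℕ}

/-- The action of a matrix on Euclidean space. -/
def mulE (A : Matrix (Fin J) (Fin J) ℝ) (u : EuclideanSpace ℝ (Fin J)) :
    EuclideanSpace ℝ (Fin J) :=
  WithLp.toLp 2 (A.mulVec u.ofLp)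

theorem mulE_add_left (A B : Matrix (Fin J) (Fin J) ℝ) (u : EuclideanSpace ℝ (Fin J)) :
    mulE (A + B) u = mulE A u + mulE B u := by
  simp [mulE, Matrix.add_mulVec]

theorem mulE_smul_left (r : ℝ) (A : Matrix (Fin J) (Fin J) ℝ) (u : EuclideanSpace ℝ (Fin J)) :
    mulE (r • A) u = r • mulE A u := by
  simp [mulE, Matrix.smul_mulVec]

theorem mulE_sub (A : Matrix (Fin J) (Fin J) ℝ) (u v : EuclideanSpace ℝ (Fin J)) :
    mulE A (u - v) = mulE A u - mulE A v := by
  simp [mulE, Matrix.mulVec_sub]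

theorem mulE_smul (A : Matrix (Fin J) (Fin J) ℝ) (r : ℝ) (u : EuclideanSpace ℝ (Fin J)) :
    mulE A (r • u) = r • mulE A u := by
  simp [mulE, Matrix.mulVec_smul]

theorem mulE_one (u : EuclideanSpace ℝ (Fin J)) : mulE 1 u = u := by
  simp [mulE]

theorem mulE_outer (φ u : EuclideanSpace ℝ (Fin J)) :
    mulE (outer φ) u = inner ℝ φ u • φ := by
  ext i
  change ∑ j, φ i * φ j * u j = inner ℝ φ u * φ i
  rw [inner_eq_sum, Finset.sum_mul]
  exact Finset.sum_congr rfl fun j _ => by ring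

theorem inner_mulE_comm {A : Matrix (Fin J) (Fin J) ℝ} (hA : A.transpose = A)
    (u v : EuclideanSpace ℝ (Fin J)) : inner ℝ u (mulE A v) = inner ℝ (mulE A u) v := by
  have h1 : ∀ u v : EuclideanSpace ℝ (Fin J), inner ℝ u v = u.ofLp ⬝ᵥ v.ofLp := inner_eq_sum
  rw [h1, h1]
  change u.ofLp ⬝ᵥ A.mulVec v.ofLp = A.mulVec u.ofLp ⬝ᵥ v.ofLp
  rw [Matrix.dotProduct_mulVec, ← Matrix.mulVec_transpose, hA]

theorem isUnit_of_lower_bound {A : Matrix (Fin J) (Fin J) ℝ} {m : ℝ} (hm : 0 < m)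
    (hA : ∀ u, m * ‖u‖ ^ 2 ≤ inner ℝ u (mulE A u)) : IsUnit A := by
  rw [← Matrix.mulVec_injective_iff_isUnit]
  intro p q hpq
  have h1 := hA (WithLp.toLp 2 p - WithLp.toLp 2 q)
  have h2 : mulE A (WithLp.toLp 2 p - WithLp.toLp 2 q) = 0 := by
    rw [mulE_sub, sub_eq_zero]
    exact congrArg (WithLp.toLp 2) hpq
  rw [h2, inner_zero_right] at h1
  have h3 : ‖(WithLp.toLp 2 p - WithLp.toLp 2 q : EuclideanSpace ℝ (Fin J))‖ ^ 2 = 0 :=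
    le_antisymm (nonpos_of_mul_nonpos_right h1 hm) (sq_nonneg _)
  have h4 := sub_eq_zero.1 (norm_eq_zero.1 (pow_eq_zero_iff two_ne_zero |>.1 h3))
  exact congrArg WithLp.ofLp h4

theorem mulE_mulE_inv {A : Matrix (Fin J) (Fin J) ℝ} (hA : IsUnit A)
    (u : EuclideanSpace ℝ (Fin J)) : mulE A (mulE A⁻¹ u) = u := by
  change WithLp.toLp 2 (A.mulVec (A⁻¹.mulVec u.ofLp)) = u
  rw [Matrix.mulVec_mulVec, Matrix.mul_nonsing_inv _ ((Matrix.isUnit_iff_isUnit_det A).1 hA),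
    Matrix.one_mulVec]

theorem norm_mulE_inv_le {A : Matrix (Fin J) (Fin J) ℝ} {m : ℝ} (hm : 0 < m)
    (hA : ∀ u, m * ‖u‖ ^ 2 ≤ inner ℝ u (mulE A u)) (u : EuclideanSpace ℝ (Fin J)) :
    ‖mulE A⁻¹ u‖ ≤ ‖u‖ / m := by
  have h1 := hA (mulE A⁻¹ u)
  rw [mulE_mulE_inv (isUnit_of_lower_bound hm hA)] at h1
  have h2 := h1.trans (real_inner_le_norm _ _)
  rw [le_div_iff₀ hm]
  rcases (norm_nonneg (mulE A⁻¹ u)).eq_or_lt with h | h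
  · rw [← h, zero_mul]; exact norm_nonneg _
  · have : ‖mulE A⁻¹ u‖ * (‖mulE A⁻¹ u‖ * m) ≤ ‖mulE A⁻¹ u‖ * ‖u‖ := by linarith
    exact le_of_mul_le_mul_left this h

theorem inner_mulE_inv_comm {A : Matrix (Fin J) (Fin J) ℝ} (hA : A.transpose = A)
    (u v : EuclideanSpace ℝ (Fin J)) : inner ℝ u (mulE A⁻¹ v) = inner ℝ (mulE A⁻¹ u) v :=
  inner_mulE_comm (by rw [Matrix.transpose_nonsing_inv, hA]) u v

/-- Expanding the nonnegative form of `A` at `A⁻¹ g - M⁻¹ g` gives the bound without any spectral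
decomposition. -/
theorem le_inner_mulE_inv {A : Matrix (Fin J) (Fin J) ℝ} {m M : ℝ} (hm : 0 < m) (hM : 0 < M)
    (hsymm : A.transpose = A)
    (hA : ∀ u, m * ‖u‖ ^ 2 ≤ inner ℝ u (mulE A u))
    (hA' : ∀ u, inner ℝ u (mulE A u) ≤ M * ‖u‖ ^ 2) (g : EuclideanSpace ℝ (Fin J)) :
    ‖g‖ ^ 2 / M ≤ inner ℝ g (mulE A⁻¹ g) := by
  set u := mulE A⁻¹ g with hu
  have hAu : mulE A u = g := mulE_mulE_inv (isUnit_of_lower_bound hm hA) g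
  have h1 : 0 ≤ inner ℝ (u - M⁻¹ • g) (mulE A (u - M⁻¹ • g)) :=
    le_trans (by positivity) (hA _)
  have h2 := hA' g
  rw [mulE_sub, mulE_smul, hAu, inner_sub_left, inner_sub_right, inner_sub_right,
    inner_smul_left, inner_smul_left, inner_smul_right, inner_smul_right,
    inner_mulE_comm hsymm u g, hAu, real_inner_self_eq_norm_sq] at h1
  simp only [conj_trivial] at h1
  rw [real_inner_comm] at h1
  have h3 : M⁻¹ * (M⁻¹ * inner ℝ g (mulE A g)) ≤ M⁻¹ * ‖g‖ ^ 2 := by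
    refine mul_le_mul_of_nonneg_left ?_ (inv_nonneg.2 hM.le)
    rw [inv_mul_le_iff₀ hM]
    exact h2
  rw [div_eq_inv_mul]
  linarith

end MatrixAction

/-! ### Deterministic upper and lower bounds on `S n`. -/

section Preconditioner

variable {J : ℕ} {𝒳 𝒴 : Type*} {ε : ℝ} {ν : Fin J → ℝ} {y : Fin J → 𝒴} {c : 𝒳 → 𝒴 → ℝ}
  {α β γ : ℝ} {v₀ : EuclideanSpace ℝ (Fin J)} {x : ℕ → 𝒳}

theorem S_zero : S ε ν y c α β γ v₀ x 0 = 1 := rfl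

theorem S_succ (n : ℕ) : S ε ν y c α β γ v₀ x (n + 1) = S ε ν y c α β γ v₀ x n +
    outer (gradh ε ν y c (x n) (V ε ν y c α β γ v₀ x n)) +
    (γ * (1 + (((n + 1) / J : ℕ) : ℝ)) ^ (-β)) • outer (Z ν (n + 1)) := rfl

theorem V_succ (n : ℕ) : V ε ν y c α β γ v₀ x (n + 1) =
    mulE (PJ J) (V ε ν y c α β γ v₀ x n - ((n : ℝ) ^ α) • mulE (S ε ν y c α β γ v₀ x n)⁻¹
      (gradh ε ν y c (x n) (V ε ν y c α β γ v₀ x n))) := rfl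

theorem outer_transpose (u : EuclideanSpace ℝ (Fin J)) : (outer u).transpose = outer u := by
  ext i j
  exact mul_comm _ _

theorem S_transpose (n : ℕ) :
    (S ε ν y c α β γ v₀ x n).transpose = S ε ν y c α β γ v₀ x n := by
  induction n with
  | zero => exact Matrix.transpose_one
  | succ n ih => rw [S_succ, Matrix.transpose_add, Matrix.transpose_add, ih, outer_transpose,
      Matrix.transpose_smul, outer_transpose]

theorem inner_S_succ (n : ℕ) (u : EuclideanSpace ℝ (Fin J)) :
    inner ℝ u (mulE (S ε ν y c α β γ v₀ x (n + 1)) u) =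
      inner ℝ u (mulE (S ε ν y c α β γ v₀ x n) u) +
      inner ℝ (gradh ε ν y c (x n) (V ε ν y c α β γ v₀ x n)) u ^ 2 +
      γ * (1 + (((n + 1) / J : ℕ) : ℝ)) ^ (-β) * inner ℝ (Z ν (n + 1)) u ^ 2 := by
  rw [S_succ, mulE_add_left, mulE_add_left, mulE_smul_left, mulE_outer, mulE_outer,
    inner_add_right, inner_add_right, inner_smul_right, inner_smul_right, inner_smul_right,
    real_inner_comm u, real_inner_comm u (Z ν (n + 1))]
  ring

theorem inner_Z_sq (hν : ∀ j, 0 < ν j) (n : ℕ) (u : EuclideanSpace ℝ (Fin J)) :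
    inner ℝ (Z ν (n + 1)) u ^ 2 =
      ∑ j : Fin J, if (j : ℕ) = n % J then ν j * u j ^ 2 else 0 := by
  rw [inner_eq_sum]
  have hZ : ∀ j, Z ν (n + 1) j = if (j : ℕ) = n % J then Real.sqrt (ν j) else 0 := fun j => rfl
  simp only [hZ]
  by_cases h : ∃ i : Fin J, (i : ℕ) = n % J
  · obtain ⟨i, hi⟩ := h
    have e : ∀ j : Fin J, ((j : ℕ) = n % J) = (j = i) := fun j => by rw [← hi, Fin.ext_iff]
    simp only [e, ite_mul, zero_mul, Finset.sum_ite_eq', Finset.mem_univ, if_true]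
    rw [mul_pow, Real.sq_sqrt (hν i).le]
  · push Not at h
    simp [h]

/-- Each block of `J` consecutive indices visits every coordinate exactly once. -/
theorem sum_range_mul_mod (q : ℕ) (a : Fin J → ℝ) :
    ∑ k ∈ Finset.range (J * q), ∑ j : Fin J, (if (j : ℕ) = k % J then a j else 0) =
      q * ∑ j, a j := by
  induction q with
  | zero => simp
  | succ q ih =>
    rw [Nat.mul_succ, Finset.sum_range_add, ih]
    have h1 : ∑ k ∈ Finset.range J, ∑ j : Fin J, (if (j : ℕ) = (J * q + k) % J then a j else 0) =
        ∑ j, a j := by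
      rw [Finset.sum_comm]
      refine Finset.sum_congr rfl fun j _ => ?_
      rw [Finset.sum_congr rfl fun k hk => by
        rw [Nat.mul_add_mod, Nat.mod_eq_of_lt (Finset.mem_range.1 hk)]]
      simp
    rw [h1]
    push_cast
    ring

theorem weights_le_one (hν : ∀ j, 0 < ν j) (hν_sum : ∑ j, ν j = 1) (j : Fin J) : ν j ≤ 1 :=
  hν_sum ▸ Finset.single_le_sum (fun i _ => (hν i).le) (Finset.mem_univ j)

theorem inner_Z_sq_le (hν : ∀ j, 0 < ν j) (hν_sum : ∑ j, ν j = 1) (n : ℕ)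
    (u : EuclideanSpace ℝ (Fin J)) : inner ℝ (Z ν (n + 1)) u ^ 2 ≤ ‖u‖ ^ 2 := by
  rw [inner_Z_sq hν, EuclideanSpace.norm_sq_eq]
  refine Finset.sum_le_sum fun j _ => ?_
  rw [Real.norm_eq_abs, sq_abs]
  split_ifs
  · exact mul_le_of_le_one_left (sq_nonneg _) (weights_le_one hν hν_sum j)
  · exact sq_nonneg _

theorem regularization_mem (hβ : 0 < β) (q : ℕ) :
    0 < (1 + (q : ℝ)) ^ (-β) ∧ (1 + (q : ℝ)) ^ (-β) ≤ 1 :=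
  ⟨by positivity, Real.rpow_le_one_of_one_le_of_nonpos (by simp) (by linarith)⟩

theorem inner_S_le (hε : 0 < ε) (hν : ∀ j, 0 < ν j) (hν_sum : ∑ j, ν j = 1) (hβ : 0 < β)
    (hγ : 0 < γ) (n : ℕ) (u : EuclideanSpace ℝ (Fin J)) :
    inner ℝ u (mulE (S ε ν y c α β γ v₀ x n) u) ≤ (5 + γ) * (n + 1) * ‖u‖ ^ 2 := by
  have key : inner ℝ u (mulE (S ε ν y c α β γ v₀ x n) u) ≤ (1 + (4 + γ) * n) * ‖u‖ ^ 2 := by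
    induction n with
    | zero => rw [S_zero, mulE_one, real_inner_self_eq_norm_sq]; simp
    | succ n ih =>
      rw [inner_S_succ]
      have h1 : inner ℝ (gradh ε ν y c (x n) (V ε ν y c α β γ v₀ x n)) u ^ 2 ≤ 4 * ‖u‖ ^ 2 := by
        rw [gradh_eq_grad hε hν hν_sum]
        set w := grad ε ν y c (x n) (V ε ν y c α β γ v₀ x n)
        have h2 := abs_real_inner_le_norm w u
        have h3 : ‖w‖ ≤ 2 := norm_grad_le hν hν_sum _ _
        rw [← sq_abs]
        calc |inner ℝ w u| ^ 2 ≤ (2 * ‖u‖) ^ 2 := by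
              gcongr
              exact h2.trans (mul_le_mul_of_nonneg_right h3 (norm_nonneg _))
          _ = 4 * ‖u‖ ^ 2 := by ring
      have h2 : γ * (1 + (((n + 1) / J : ℕ) : ℝ)) ^ (-β) * inner ℝ (Z ν (n + 1)) u ^ 2 ≤
          γ * 1 * ‖u‖ ^ 2 :=
        mul_le_mul (mul_le_mul_of_nonneg_left (regularization_mem hβ _).2 hγ.le)
          (inner_Z_sq_le hν hν_sum n u) (sq_nonneg _) (by positivity)
      push_cast
      linarith
  refine key.trans (mul_le_mul_of_nonneg_right ?_ (sq_nonneg _))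
  have : (0 : ℝ) ≤ n := n.cast_nonneg
  linarith

theorem le_inner_S_sum (n : ℕ) (u : EuclideanSpace ℝ (Fin J)) :
    ‖u‖ ^ 2 + ∑ k ∈ Finset.range n,
      γ * (1 + (((k + 1) / J : ℕ) : ℝ)) ^ (-β) * inner ℝ (Z ν (k + 1)) u ^ 2 ≤
    inner ℝ u (mulE (S ε ν y c α β γ v₀ x n) u) := by
  induction n with
  | zero => rw [S_zero, mulE_one, real_inner_self_eq_norm_sq]; simp
  | succ n ih =>
    rw [inner_S_succ, Finset.sum_range_succ]
    have := sq_nonneg (inner ℝ (gradh ε ν y c (x n) (V ε ν y c α β γ v₀ x n)) u)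
    linarith

/-- Each full block of `J` steps adds at least `γ (1 + q)^(-β) diag ν`, where `q = n / J` and the
smallest coefficient is used throughout. That `κ` is independent of the trajectory makes the
Robbins–Siegmund error deterministic. -/
theorem exists_le_inner_S (hν : ∀ j, 0 < ν j) (hν_sum : ∑ j, ν j = 1) (hβ : 0 < β)
    (hβ1 : β ≤ 1) (hγ : 0 < γ) :
    ∃ κ, 0 < κ ∧ ∀ (v₀ : EuclideanSpace ℝ (Fin J)) (x : ℕ → 𝒳) (n : ℕ)
      (u : EuclideanSpace ℝ (Fin J)),
      κ * ((n : ℝ) + 1) ^ (1 - β) * ‖u‖ ^ 2 ≤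
        inner ℝ u (mulE (S ε ν y c α β γ v₀ x n) u) := by
  have hne := nonempty_of_sum_eq_one hν_sum
  have hJ : 0 < J := by obtain ⟨i⟩ := hne; exact i.pos
  obtain ⟨i, hi⟩ := Finite.exists_min ν
  set κ := min 1 (γ * ν i) with hκ
  have hκ0 : 0 < κ := lt_min one_pos (mul_pos hγ (hν i))
  refine ⟨κ * (1 / (J : ℝ)) ^ (1 - β), by positivity, fun v₀ x n u => ?_⟩
  refine le_trans ?_ (le_inner_S_sum n u)
  set q := n / J with hq
  have hr := regularization_mem hβ q
  set r := (1 + (q : ℝ)) ^ (-β) with hrdef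
  have hsum : γ * r * (q * (ν i * ‖u‖ ^ 2)) ≤ ∑ k ∈ Finset.range n,
      γ * (1 + (((k + 1) / J : ℕ) : ℝ)) ^ (-β) * inner ℝ (Z ν (k + 1)) u ^ 2 := by
    calc γ * r * (q * (ν i * ‖u‖ ^ 2)) ≤ γ * r * (q * ∑ j, ν j * u j ^ 2) := by
          have h1 : ν i * ‖u‖ ^ 2 ≤ ∑ j, ν j * u j ^ 2 := by
            rw [EuclideanSpace.norm_sq_eq, Finset.mul_sum]
            refine Finset.sum_le_sum fun j _ => ?_
            rw [Real.norm_eq_abs, sq_abs]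
            exact mul_le_mul_of_nonneg_right (hi j) (sq_nonneg _)
          gcongr
      _ = ∑ k ∈ Finset.range (J * q), γ * r * inner ℝ (Z ν (k + 1)) u ^ 2 := by
          rw [← Finset.mul_sum, ← sum_range_mul_mod]
          simp only [inner_Z_sq hν]
      _ ≤ ∑ k ∈ Finset.range n, γ * r * inner ℝ (Z ν (k + 1)) u ^ 2 := by
          refine Finset.sum_le_sum_of_subset_of_nonneg
            (Finset.range_subset_range.2 (Nat.mul_div_le n J)) fun k _ _ => ?_
          have := hr.1
          positivity
      _ ≤ _ := by
          refine Finset.sum_le_sum fun k hk => ?_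
          refine mul_le_mul_of_nonneg_right (mul_le_mul_of_nonneg_left ?_ hγ.le) (sq_nonneg _)
          refine Real.rpow_le_rpow_of_nonpos (by positivity) ?_ (by linarith)
          have h1 : (k + 1) / J ≤ q := Nat.div_le_div_right (Finset.mem_range.1 hk)
          have h2 : (((k + 1) / J : ℕ) : ℝ) ≤ q := by exact_mod_cast h1
          linarith
  have hq1 : ((n : ℝ) + 1) / J ≤ 1 + q := by
    rw [div_le_iff₀ (by exact_mod_cast hJ)]
    have h1 : n + 1 ≤ (1 + q) * J := by
      have := Nat.lt_mul_div_succ n hJ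
      rw [← hq] at this
      nlinarith
    exact_mod_cast h1
  have hpow : (1 / (J : ℝ)) ^ (1 - β) * ((n : ℝ) + 1) ^ (1 - β) ≤ (1 + q) * r := by
    rw [← Real.mul_rpow (by positivity) (by positivity), hrdef]
    calc (1 / (J : ℝ) * (n + 1)) ^ (1 - β) ≤ (1 + (q : ℝ)) ^ (1 - β) := by
          refine Real.rpow_le_rpow (by positivity) ?_ (by linarith)
          rw [one_div_mul_eq_div]
          exact hq1
      _ = (1 + q) * (1 + (q : ℝ)) ^ (-β) := by
          rw [sub_eq_add_neg, Real.rpow_add (by positivity), Real.rpow_one]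
  -- The initial identity matrix pays for the summand `1` in `1 + q`, the `q` full blocks for the
  -- rest; hence the minimum in `κ`.
  have h1 : κ * ((1 + q) * r) ≤ 1 + γ * r * (q * ν i) := by
    have h2 : κ ≤ 1 := min_le_left _ _
    have h3 : κ ≤ γ * ν i := min_le_right _ _
    have h4 : κ * r ≤ 1 := by nlinarith [hr.1, hr.2]
    have h5 : κ * (q * r) ≤ γ * ν i * (q * r) :=
      mul_le_mul_of_nonneg_right h3 (mul_nonneg q.cast_nonneg hr.1.le)
    linarith
  calc κ * (1 / (J : ℝ)) ^ (1 - β) * ((n : ℝ) + 1) ^ (1 - β) * ‖u‖ ^ 2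
      = κ * ((1 / (J : ℝ)) ^ (1 - β) * ((n : ℝ) + 1) ^ (1 - β)) * ‖u‖ ^ 2 := by ring
    _ ≤ κ * ((1 + q) * r) * ‖u‖ ^ 2 := by gcongr
    _ ≤ (1 + γ * r * (q * ν i)) * ‖u‖ ^ 2 := by gcongr
    _ = ‖u‖ ^ 2 + γ * r * (q * (ν i * ‖u‖ ^ 2)) := by ring
    _ ≤ _ := by linarith

theorem sum_V_succ (hJ : 0 < J) (n : ℕ) : ∑ j, V ε ν y c α β γ v₀ x (n + 1) j = 0 := by
  rw [V_succ]
  simp only [mulE]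
  rw [Finset.sum_congr rfl fun j _ => mulVec_PJ_apply hJ _ j, Finset.sum_sub_distrib]
  have : (J : ℝ) ≠ 0 := by positivity
  simp [mul_div_cancel₀ _ this]

end Preconditioner

/-! ### Measurability of the recursion. -/

section Measurability

variable {J : ℕ} {Ω : Type*} {m : MeasurableSpace Ω}

theorem measurable_det {A : Ω → Matrix (Fin J) (Fin J) ℝ}
    (hA : ∀ i j, Measurable fun ω => A ω i j) : Measurable fun ω => (A ω).det := by
  simp only [Matrix.det_apply]
  exact Finset.measurable_sum _ fun σ _ =>
    (Finset.measurable_prod _ fun i _ => hA (σ i) i).const_smul (Equiv.Perm.sign σ)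

theorem measurable_inv_apply {A : Ω → Matrix (Fin J) (Fin J) ℝ}
    (hA : ∀ i j, Measurable fun ω => A ω i j) (i j : Fin J) :
    Measurable fun ω => (A ω)⁻¹ i j := by
  simp only [Matrix.inv_def, Matrix.smul_apply, Matrix.adjugate_apply, Ring.inverse_eq_inv',
    smul_eq_mul]
  refine (measurable_det hA).inv.mul (measurable_det fun k l => ?_)
  simp only [Matrix.updateRow_apply]
  by_cases h : k = j
  · simp [h]
  · simpa [h] using hA k l

theorem measurable_coord {u : Ω → EuclideanSpace ℝ (Fin J)} (hu : Measurable u) (j : Fin J) :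
    Measurable fun ω => u ω j :=
  (EuclideanSpace.proj (𝕜 := ℝ) j).continuous.measurable.comp hu

theorem measurable_mulE {A : Ω → Matrix (Fin J) (Fin J) ℝ} {u : Ω → EuclideanSpace ℝ (Fin J)}
    (hA : ∀ i j, Measurable fun ω => A ω i j) (hu : Measurable u) :
    Measurable fun ω => mulE (A ω) (u ω) := by
  refine (WithLp.measurable_toLp 2 _).comp (measurable_pi_lambda _ fun i => ?_)
  have h1 : Measurable fun ω => ∑ j, A ω i j * u ω j :=
    Finset.measurable_fun_sum _ fun j _ => (hA i j).mul (measurable_coord hu j)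
  exact h1

variable {𝒳 𝒴 : Type*} [MeasurableSpace 𝒳] {ε : ℝ} {ν : Fin J → ℝ} {y : Fin J → 𝒴}
  {c : 𝒳 → 𝒴 → ℝ} {α β γ : ℝ}

/-- The σ-algebra is arbitrary and only the first `n` observations need be measurable for it, so the
choice of the past σ-algebra yields adaptedness. -/
theorem measurable_iter (hε : 0 < ε) (hν : ∀ j, 0 < ν j) (hν_sum : ∑ j, ν j = 1)
    (hc : ∀ j, Measurable fun x => c x (y j)) {V₀ : Ω → EuclideanSpace ℝ (Fin J)}
    {X : ℕ → Ω → 𝒳} (hV₀ : Measurable V₀) (n : ℕ) (hX : ∀ k < n, Measurable (X k)) :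
    (Measurable fun ω => V ε ν y c α β γ (V₀ ω) (fun k => X k ω) n) ∧
    ∀ i j, Measurable fun ω => S ε ν y c α β γ (V₀ ω) (fun k => X k ω) n i j := by
  induction n with
  | zero => exact ⟨hV₀, fun i j => measurable_const⟩
  | succ n ih =>
    obtain ⟨h1, h2⟩ := ih fun k hk => hX k (hk.trans n.lt_succ_self)
    have h3 : Measurable fun ω => gradh ε ν y c (X n ω)
        (V ε ν y c α β γ (V₀ ω) (fun k => X k ω) n) := by
      simp only [gradh_eq_grad hε hν hν_sum]
      exact measurable_grad hc (hX n n.lt_succ_self) h1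
    refine ⟨?_, fun i j => ?_⟩
    · have h4 := (measurable_mulE (measurable_inv_apply h2) h3).const_smul ((n : ℝ) ^ α)
      simp only [V_succ]
      exact measurable_mulE (fun i j => measurable_const) (h1.sub h4)
    · simp only [S_succ, Matrix.add_apply, Matrix.smul_apply]
      exact ((h2 i j).add ((measurable_coord h3 i).mul (measurable_coord h3 j))).add
        measurable_const

end Measurability

/-! ### The past filtration and its independence from the next observation. -/

section Independence

variable {Ω : Type*}

/-- The joint law is a triple product, which is reassociated. -/
theorem indepFun_prodMk_left [MeasurableSpace Ω] {P : Measure Ω} {𝓐 𝓑 𝓒 : Type*} [MeasurableSpace 𝓐] [MeasurableSpace 𝓑]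
    [MeasurableSpace 𝓒] [IsProbabilityMeasure P] {f : Ω → 𝓐} {g : Ω → 𝓑} {k : Ω → 𝓒}
    (hf : Measurable f) (hg : Measurable g) (hk : Measurable k)
    (hfgk : IndepFun f (fun ω => (g ω, k ω)) P) (hgk : IndepFun g k P) :
    IndepFun (fun ω => (f ω, g ω)) k P := by
  have hfg : IndepFun f g P := hfgk.comp measurable_id measurable_fst
  rw [indepFun_iff_map_prod_eq_prod_map_map (by fun_prop) (by fun_prop)] at hfgk hgk hfg ⊢
  have := Measure.isProbabilityMeasure_map (μ := P) hf.aemeasurable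
  have := Measure.isProbabilityMeasure_map (μ := P) hg.aemeasurable
  have := Measure.isProbabilityMeasure_map (μ := P) hk.aemeasurable
  rw [hfg, ← (measurePreserving_prodAssoc (P.map f) (P.map g) (P.map k)).symm.map_eq, ← hgk,
    ← hfgk, Measure.map_map (MeasurableEquiv.measurable _) (by fun_prop)]
  rfl

variable {𝒳 𝓔 : Type*} [MeasurableSpace 𝒳] [MeasurableSpace 𝓔]

/-- The initial value together with the first `n` observations. -/
def past (V₀ : Ω → 𝓔) (X : ℕ → Ω → 𝒳) (n : ℕ) (ω : Ω) : 𝓔 × (Finset.range n → 𝒳) :=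
  (V₀ ω, fun k => X k ω)

theorem measurable_past {m : MeasurableSpace Ω} {V₀ : Ω → 𝓔} {X : ℕ → Ω → 𝒳} {n : ℕ}
    (hV₀ : Measurable V₀) (hX : ∀ k < n, Measurable (X k)) : Measurable (past V₀ X n) :=
  hV₀.prodMk (measurable_pi_lambda _ fun k => hX k (Finset.mem_range.1 k.2))

theorem comap_past_measurable_init (V₀ : Ω → 𝓔) (X : ℕ → Ω → 𝒳) (n : ℕ) :
    Measurable[MeasurableSpace.comap (past V₀ X n) inferInstance] V₀ :=
  measurable_fst.comp (comap_measurable (past V₀ X n))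

theorem comap_past_measurable_obs (V₀ : Ω → 𝓔) (X : ℕ → Ω → 𝒳) {n k : ℕ} (hk : k < n) :
    Measurable[MeasurableSpace.comap (past V₀ X n) inferInstance] (X k) :=
  ((measurable_pi_apply (⟨k, Finset.mem_range.2 hk⟩ : Finset.range n)).comp measurable_snd).comp
    (comap_measurable (past V₀ X n))

/-- The filtration generated by the initial value and the observations. -/
def pastFiltration [mΩ : MeasurableSpace Ω] {V₀ : Ω → 𝓔} {X : ℕ → Ω → 𝒳} (hV₀ : Measurable V₀)
    (hX : ∀ n, Measurable (X n)) : Filtration ℕ mΩ where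
  seq n := MeasurableSpace.comap (past V₀ X n) inferInstance
  mono' _ m hnm := Measurable.comap_le (measurable_past (comap_past_measurable_init V₀ X m)
    fun _ hk => comap_past_measurable_obs V₀ X (hk.trans_le hnm))
  le' _ := Measurable.comap_le (measurable_past hV₀ fun k _ => hX k)

theorem indepFun_past [MeasurableSpace Ω] {P : Measure Ω} [IsProbabilityMeasure P] {V₀ : Ω → 𝓔} {X : ℕ → Ω → 𝒳} (hV₀ : Measurable V₀)
    (hX : ∀ n, Measurable (X n)) (hX_indep : iIndepFun X P)
    (hV₀_indep : IndepFun V₀ (fun ω n => X n ω) P) (n : ℕ) :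
    IndepFun (past V₀ X n) (X n) P := by
  refine indepFun_prodMk_left hV₀ (measurable_pi_lambda _ fun k => hX k) (hX n) ?_ ?_
  · have h1 : Measurable fun x : ℕ → 𝒳 => ((fun k : Finset.range n => x k), x n) := by
      fun_prop
    exact hV₀_indep.comp measurable_id h1
  · have h1 := hX_indep.indepFun_finset (Finset.range n) {n} (by simp) hX
    exact h1.comp measurable_id
      (measurable_pi_apply (⟨n, Finset.mem_singleton_self n⟩ : ({n} : Finset ℕ)))

end Independence

/-! ### Averaging out the fresh observation. -/

section Expectation

variable {J : ℕ} {Ω : Type*} [mΩ : MeasurableSpace Ω] {P : Measure Ω}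
  {𝒳 𝒴 : Type*} [MeasurableSpace 𝒳] {μ : Measure 𝒳} [IsProbabilityMeasure μ]
  {ε : ℝ} {ν : Fin J → ℝ} {y : Fin J → 𝒴} {c : 𝒳 → 𝒴 → ℝ}

theorem integrable_inner_grad (hν : ∀ j, 0 < ν j) (hν_sum : ∑ j, ν j = 1)
    (hc : ∀ j, Measurable fun x => c x (y j)) {ξ : Ω → 𝒳} (hξ : Measurable ξ)
    {q v : Ω → EuclideanSpace ℝ (Fin J)} (hq : Integrable q P) (hv : Measurable v) :
    Integrable (fun ω => inner ℝ (q ω) (grad ε ν y c (ξ ω) (v ω))) P := by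
  have h1 : Measurable fun ω => grad ε ν y c (ξ ω) (v ω) :=
    measurable_grad hc hξ hv
  refine (hq.norm.mul_const 2).mono' (hq.aestronglyMeasurable.inner h1.aestronglyMeasurable)
    (Eventually.of_forall fun ω => ?_)
  exact (norm_inner_le_norm _ _).trans
    (mul_le_mul_of_nonneg_left (norm_grad_le hν hν_sum _ _) (norm_nonneg _))

/-- The stochastic gradient is unbiased given the past: the joint law is a product, and Fubini
integrates `ξ` with `(q, v)` frozen. -/
theorem integral_inner_grad [IsProbabilityMeasure P] (hν : ∀ j, 0 < ν j) (hν_sum : ∑ j, ν j = 1)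
    (hc : ∀ j, Measurable fun x => c x (y j)) {ξ : Ω → 𝒳} (hξ : Measurable ξ)
    (hξ_law : P.map ξ = μ) {q v : Ω → EuclideanSpace ℝ (Fin J)} (hqm : Measurable q)
    (hq : Integrable q P) (hv : Measurable v) (hind : IndepFun (fun ω => (q ω, v ω)) ξ P) :
    ∫ ω, inner ℝ (q ω) (grad ε ν y c (ξ ω) (v ω)) ∂P =
      ∫ ω, inner ℝ (q ω) (meanGrad ε ν y c μ (v ω)) ∂P := by
  have hW : Measurable fun ω => (q ω, v ω) := hqm.prodMk hv
  set f : (EuclideanSpace ℝ (Fin J) × EuclideanSpace ℝ (Fin J)) × 𝒳 → ℝ :=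
    fun w => inner ℝ w.1.1 (grad ε ν y c w.2 w.1.2) with hf
  have hgm : Measurable fun w : (EuclideanSpace ℝ (Fin J) × EuclideanSpace ℝ (Fin J)) × 𝒳 =>
      grad ε ν y c w.2 w.1.2 :=
    measurable_grad hc measurable_snd (measurable_snd.comp measurable_fst)
  have hfm : Measurable f := (measurable_fst.comp measurable_fst).inner hgm
  have hmap := (indepFun_iff_map_prod_eq_prod_map_map hW.aemeasurable hξ.aemeasurable).1 hind
  rw [hξ_law] at hmap
  have := Measure.isProbabilityMeasure_map (μ := P) hW.aemeasurable
  have hWξ : Measurable fun ω => ((q ω, v ω), ξ ω) := hW.prodMk hξ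
  have hfi : Integrable f ((P.map fun ω => (q ω, v ω)).prod μ) := by
    rw [← hmap, integrable_map_measure hfm.aestronglyMeasurable hWξ.aemeasurable]
    exact integrable_inner_grad hν hν_sum hc hξ hq hv
  calc ∫ ω, inner ℝ (q ω) (grad ε ν y c (ξ ω) (v ω)) ∂P
      = ∫ w, f w ∂(P.map fun ω => ((q ω, v ω), ξ ω)) :=
        (integral_map hWξ.aemeasurable hfm.aestronglyMeasurable).symm
    _ = ∫ w, ∫ x, f (w, x) ∂μ ∂(P.map fun ω => (q ω, v ω)) := by
        rw [hmap, integral_prod f hfi]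
    _ = ∫ w, inner ℝ w.1 (meanGrad ε ν y c μ w.2) ∂(P.map fun ω => (q ω, v ω)) := by
        refine integral_congr_ae (Eventually.of_forall fun w => ?_)
        exact integral_inner (integrable_grad hν hν_sum hc w.2) w.1
    _ = _ := by
        refine integral_map hW.aemeasurable (Measurable.aestronglyMeasurable ?_)
        exact measurable_fst.inner ((measurable_meanGrad hc).comp measurable_snd)

end Expectation

/-! ### One-step descent and the deterministic end of the argument. -/

section Descent

variable {J : ℕ} {𝒳 𝒴 : Type*} [MeasurableSpace 𝒳] {μ : Measure 𝒳} [IsProbabilityMeasure μ]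
  {ε : ℝ} {ν : Fin J → ℝ} {y : Fin J → 𝒴} {c : 𝒳 → 𝒴 → ℝ} {α β γ : ℝ}

/-- One step of the algorithm decreases the objective up to a noise and a second order term. -/
theorem H_V_succ_le (hε : 0 < ε) (hν : ∀ j, 0 < ν j) (hν_sum : ∑ j, ν j = 1)
    (hc : ∀ j, Measurable fun x => c x (y j)) (hci : ∀ j, Integrable (fun x => c x (y j)) μ)
    (hc0 : ∀ x z, 0 ≤ c x z) {v₀ : EuclideanSpace ℝ (Fin J)} {x : ℕ → 𝒳} {n : ℕ} {m : ℝ}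
    (hm : 0 < m)
    (hS : ∀ u, m * ‖u‖ ^ 2 ≤ inner ℝ u (mulE (S ε ν y c α β γ v₀ x n) u)) :
    H ε ν y c μ (V ε ν y c α β γ v₀ x (n + 1)) ≤ H ε ν y c μ (V ε ν y c α β γ v₀ x n) -
      inner ℝ (((n : ℝ) ^ α) • mulE (S ε ν y c α β γ v₀ x n)⁻¹
        (meanGrad ε ν y c μ (V ε ν y c α β γ v₀ x n)))
        (grad ε ν y c (x n) (V ε ν y c α β γ v₀ x n)) +
      4 / ε * ((n : ℝ) ^ α * (2 / m)) ^ 2 := by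
  have hJ : 0 < J := by obtain ⟨i⟩ := nonempty_of_sum_eq_one hν_sum; exact i.pos
  rw [V_succ, gradh_eq_grad hε hν hν_sum]
  set v := V ε ν y c α β γ v₀ x n
  set A := S ε ν y c α β γ v₀ x n with hA
  set φ := grad ε ν y c (x n) v
  set w := v - ((n : ℝ) ^ α) • mulE A⁻¹ φ with hw
  have h1 : H ε ν y c μ (mulE (PJ J) w) = H ε ν y c μ w :=
    H_add_const hε hν hν_sum (a := -((∑ j, w j) / J)) fun j => mulVec_PJ_apply hJ w.ofLp j
  have h2 := H_le_quadratic (μ := μ) hε hν hν_sum hc hci hc0 v w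
  have e : w - v = -(((n : ℝ) ^ α) • mulE A⁻¹ φ) := by rw [hw]; abel
  have hn : (0 : ℝ) ≤ (n : ℝ) ^ α := by positivity
  -- Symmetry moves `A⁻¹` onto the mean gradient, so the new observation enters the first-order term
  -- only through `φ`, paired with a vector known from the past.
  rw [e, inner_neg_right, inner_smul_right, norm_neg, norm_smul, Real.norm_of_nonneg hn,
    inner_mulE_inv_comm (S_transpose n)] at h2
  rw [h1, inner_smul_left, conj_trivial]
  have h3 : ‖mulE A⁻¹ φ‖ ≤ 2 / m := (norm_mulE_inv_le hm hS φ).trans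
    (div_le_div_of_nonneg_right (norm_grad_le hν hν_sum _ _) hm.le)
  have h4 : 4 / ε * ((n : ℝ) ^ α * ‖mulE A⁻¹ φ‖) ^ 2 ≤ 4 / ε * ((n : ℝ) ^ α * (2 / m)) ^ 2 := by
    gcongr
  linarith

theorem not_summable_of_le_inv {a : ℕ → ℝ} {δ : ℝ} (hδ : 0 < δ)
    (ha : ∀ᶠ n : ℕ in atTop, δ / ((n : ℝ) + 1) ≤ a n) : ¬ Summable a := by
  intro hs
  have h1 : Summable fun n : ℕ => δ / ((n : ℝ) + 1) :=
    hs.of_norm_bounded_eventually_nat (by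
      filter_upwards [ha] with n hn
      rwa [Real.norm_of_nonneg (by positivity)])
  have h2 : Summable fun n : ℕ => 1 / ((n : ℝ) + 1) := by
    refine (h1.mul_left δ⁻¹).congr fun n => ?_
    field_simp
  refine Real.not_summable_one_div_natCast ((summable_nat_add_iff 1).1 ?_)
  simpa using h2

/-- A positive limit `l` would confine `u n` to a ball of radius `R`; convexity bounds the gap by
`‖∇H‖ R`, so `‖∇H‖ ≥ l / (2R)` eventually, contradicting summability against `1 / (n + 1)`. -/
theorem tendsto_of_summable_norm_meanGrad (hε : 0 < ε) (hν : ∀ j, 0 < ν j)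
    (hν_sum : ∑ j, ν j = 1)
    (hc : ∀ j, Measurable fun x => c x (y j)) (hci : ∀ j, Integrable (fun x => c x (y j)) μ)
    (hc0 : ∀ x z, 0 ≤ c x z) {v : EuclideanSpace ℝ (Fin J)}
    (hmin : ∀ w, H ε ν y c μ v ≤ H ε ν y c μ w) (hv : ∑ j, v j = 0)
    {u : ℕ → EuclideanSpace ℝ (Fin J)} (hu : ∀ n, ∑ j, u (n + 1) j = 0) {l : ℝ}
    (hl : Tendsto (fun n => H ε ν y c μ (u n) - H ε ν y c μ v) atTop (𝓝 l))
    {a : ℕ → ℝ} (ha : Summable a) {C : ℝ} (hC : 0 < C)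
    (hua : ∀ᶠ n : ℕ in atTop, C * ‖meanGrad ε ν y c μ (u n)‖ ^ 2 / ((n : ℝ) + 1) ≤ a n) :
    Tendsto u atTop (𝓝 v) := by
  have hu' : ∀ᶠ n in atTop, ∑ j, u n j = 0 := by
    filter_upwards [eventually_ge_atTop 1] with n hn
    obtain ⟨k, rfl⟩ := Nat.exists_eq_add_of_le' hn
    exact hu k
  have hl0 : 0 ≤ l := ge_of_tendsto' hl fun n => sub_nonneg.2 (hmin _)
  have hlz : l = 0 := by
    by_contra hne
    have hlpos : 0 < l := lt_of_le_of_ne hl0 (Ne.symm hne)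
    obtain ⟨m, hm, hgrow⟩ := exists_growth (μ := μ) hε hν hν_sum hc hci hc0 hmin hv one_pos
    set R := max 1 ((l + 1) / m) with hR
    have hR0 : 0 < R := lt_of_lt_of_le one_pos (le_max_left _ _)
    refine not_summable_of_le_inv (δ := C * (l / 2 / R) ^ 2) (by positivity) ?_ ha
    filter_upwards [hua, hu', hl.eventually (lt_mem_nhds (half_lt_self hlpos)),
      hl.eventually (gt_mem_nhds (lt_add_one l))] with n h1 h2 h3 h4
    have hbd : ‖u n - v‖ ≤ R := by
      by_contra hcon
      push Not at hcon
      have h5 := hgrow (u n) h2 ((le_max_left _ _).trans hcon.le)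
      have h6 : (l + 1) / m < ‖u n - v‖ := (le_max_right _ _).trans_lt hcon
      rw [div_lt_iff₀ hm] at h6
      linarith
    have h5 := H_ge_linear (μ := μ) hε hν hν_sum hc hci hc0 (u n) v
    have h6 := (abs_le.1 (abs_real_inner_le_norm (meanGrad ε ν y c μ (u n)) (v - u n))).1
    rw [norm_sub_rev] at h6
    have h7 : l / 2 / R ≤ ‖meanGrad ε ν y c μ (u n)‖ := by
      rw [div_le_iff₀ hR0]
      have := mul_le_mul_of_nonneg_left hbd (norm_nonneg (meanGrad ε ν y c μ (u n)))
      linarith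
    refine le_trans ?_ h1
    gcongr
  rw [hlz] at hl
  rw [Metric.tendsto_atTop']
  intro r hr
  obtain ⟨m, hm, hgrow⟩ := exists_growth (μ := μ) hε hν hν_sum hc hci hc0 hmin hv hr
  have h1 := (hl.eventually (gt_mem_nhds (mul_pos hm hr))).and hu'
  obtain ⟨N, hN⟩ := eventually_atTop.1 h1
  refine ⟨N, fun n hn => ?_⟩
  obtain ⟨h2, h3⟩ := hN n hn.le
  rw [dist_eq_norm]
  by_contra hcon
  push Not at hcon
  have h4 := hgrow (u n) h3 hcon
  have := mul_le_mul_of_nonneg_left hcon hm.le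
  linarith

theorem summable_second_order (hα : 0 ≤ α) (hαβ : α + β < 1 / 2) {κ : ℝ} (hκ : 0 < κ) (C : ℝ) :
    Summable fun n : ℕ => C * ((n : ℝ) ^ α * (2 / (κ * ((n : ℝ) + 1) ^ (1 - β)))) ^ 2 := by
  refine Summable.mul_left C ?_
  have h1 : Summable fun n : ℕ => (2 / κ) ^ 2 * ((n : ℝ) + 1) ^ (2 * (α + β - 1)) := by
    refine Summable.mul_left _ ?_
    have h2 := (summable_nat_add_iff 1).2
      (Real.summable_nat_rpow.2 (show 2 * (α + β - 1) < -1 by linarith))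
    simpa using h2
  refine h1.of_nonneg_of_le (fun n => by positivity) fun n => ?_
  have hn : (0 : ℝ) < (n : ℝ) + 1 := by positivity
  have h3 : (n : ℝ) ^ α ≤ ((n : ℝ) + 1) ^ α :=
    Real.rpow_le_rpow n.cast_nonneg (by linarith) hα
  calc ((n : ℝ) ^ α * (2 / (κ * ((n : ℝ) + 1) ^ (1 - β)))) ^ 2
      ≤ (((n : ℝ) + 1) ^ α * (2 / (κ * ((n : ℝ) + 1) ^ (1 - β)))) ^ 2 := by gcongr
    _ = (2 / κ * ((n : ℝ) + 1) ^ (α + β - 1)) ^ 2 := by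
        congr 1
        have h4 : ((n : ℝ) + 1) ^ α = ((n : ℝ) + 1) ^ (α + β - 1) * ((n : ℝ) + 1) ^ (1 - β) := by
          rw [← Real.rpow_add hn]; congr 1; ring
        have h5 : ((n : ℝ) + 1) ^ (1 - β) ≠ 0 := (Real.rpow_pos_of_pos hn _).ne'
        rw [h4]
        field_simp
    _ = _ := by
        rw [mul_pow, two_mul (α + β - 1), Real.rpow_add hn, ← sq]

end Descent

/-! ### Cesàro ingredients for `S n / n`. -/

section Averages

variable {J : ℕ} {𝒳 𝒴 : Type*} {ε : ℝ} {ν : Fin J → ℝ} {y : Fin J → 𝒴} {c : 𝒳 → 𝒴 → ℝ}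
  {α β γ : ℝ}

theorem abs_coord_grad_le (hν : ∀ j, 0 < ν j) (hν_sum : ∑ j, ν j = 1) (x : 𝒳)
    (v : EuclideanSpace ℝ (Fin J)) (j : Fin J) : |grad ε ν y c x v j| ≤ 2 :=
  (PiLp.norm_apply_le (grad ε ν y c x v) j).trans (norm_grad_le hν hν_sum x v)

theorem tendsto_outer_sub (hε : 0 < ε) (hν : ∀ j, 0 < ν j) (hν_sum : ∑ j, ν j = 1)
    {v : EuclideanSpace ℝ (Fin J)} {u : ℕ → EuclideanSpace ℝ (Fin J)}
    (hu : Tendsto u atTop (𝓝 v)) (x : ℕ → 𝒳) (i j : Fin J) :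
    Tendsto (fun n => outer (grad ε ν y c (x n) (u n)) i j - outer (grad ε ν y c (x n) v) i j)
      atTop (𝓝 0) := by
  have h1 : Tendsto (fun n => 4 * (Real.exp (2 * (‖u n - v‖ / ε)) - 1)) atTop (𝓝 0) := by
    have hc : Continuous fun w => 4 * (Real.exp (2 * (‖w - v‖ / ε)) - 1) := by fun_prop
    have := (hc.tendsto v).comp hu
    simpa [Function.comp_def] using this
  refine squeeze_zero_norm (fun n => ?_) h1
  have hd : ∀ j, |grad ε ν y c (x n) (u n) j - grad ε ν y c (x n) v j| ≤
      Real.exp (2 * (‖u n - v‖ / ε)) - 1 := fun j => by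
    have := abs_weight_sub_le (y := y) (c := c) hε hν hν_sum (x n) v (u n) j
    have e : grad ε ν y c (x n) (u n) j - grad ε ν y c (x n) v j =
        weight ε ν y c (x n) (u n) j - weight ε ν y c (x n) v j := sub_sub_sub_cancel_right _ _ _
    rwa [e]
  have e : outer (grad ε ν y c (x n) (u n)) i j - outer (grad ε ν y c (x n) v) i j =
      (grad ε ν y c (x n) (u n) i - grad ε ν y c (x n) v i) * grad ε ν y c (x n) (u n) j +
      grad ε ν y c (x n) v i * (grad ε ν y c (x n) (u n) j - grad ε ν y c (x n) v j) := by
    simp only [outer, Matrix.vecMulVec_apply]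
    ring
  rw [e, Real.norm_eq_abs]
  refine (abs_add_le _ _).trans ?_
  rw [abs_mul, abs_mul]
  have h2 := mul_le_mul (hd i) (abs_coord_grad_le (ε := ε) (y := y) (c := c) hν hν_sum (x n) (u n) j)
    (abs_nonneg _) ((abs_nonneg _).trans (hd i))
  have h3 := mul_le_mul (abs_coord_grad_le (ε := ε) (y := y) (c := c) hν hν_sum (x n) v i) (hd j)
    (abs_nonneg _) two_pos.le
  linarith

theorem tendsto_regularization (hJ : 0 < J) (hν : ∀ j, 0 < ν j) (hν_sum : ∑ j, ν j = 1)
    (hβ : 0 < β) (i j : Fin J) :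
    Tendsto (fun n : ℕ => γ * (1 + (((n + 1) / J : ℕ) : ℝ)) ^ (-β) * outer (Z ν (n + 1)) i j)
      atTop (𝓝 0) := by
  have h1 : Tendsto (fun n : ℕ => (1 + (((n + 1) / J : ℕ) : ℝ))) atTop atTop := by
    refine tendsto_atTop_add_const_left _ _ (tendsto_natCast_atTop_atTop.comp ?_)
    exact (Nat.tendsto_div_const_atTop hJ.ne').comp (tendsto_add_atTop_nat 1)
  have h2 := (tendsto_rpow_neg_atTop hβ).comp h1
  have h3 : Tendsto (fun n : ℕ => |γ| * (1 + (((n + 1) / J : ℕ) : ℝ)) ^ (-β)) atTop (𝓝 0) := by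
    simpa using h2.const_mul |γ|
  refine squeeze_zero_norm (fun n => ?_) h3
  have hZ : ∀ j, |Z ν (n + 1) j| ≤ 1 := fun j => by
    have e : Z ν (n + 1) j = if (j : ℕ) = n % J then Real.sqrt (ν j) else 0 := rfl
    rw [e]
    split_ifs
    · rw [abs_of_nonneg (Real.sqrt_nonneg _)]
      exact Real.sqrt_le_one.2 (weights_le_one hν hν_sum j)
    · simp
  have e : outer (Z ν (n + 1)) i j = Z ν (n + 1) i * Z ν (n + 1) j := rfl
  have hr := (regularization_mem hβ ((n + 1) / J)).1.le
  rw [norm_mul, norm_mul, e, norm_mul, Real.norm_eq_abs γ, Real.norm_of_nonneg hr]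
  refine mul_le_of_le_one_right (by positivity) ?_
  exact mul_le_one₀ (hZ i) (abs_nonneg _) (hZ j)

theorem S_apply_eq_sum (hε : 0 < ε) (hν : ∀ j, 0 < ν j) (hν_sum : ∑ j, ν j = 1)
    (v₀ : EuclideanSpace ℝ (Fin J)) (x : ℕ → 𝒳) (n : ℕ) (i j : Fin J) :
    S ε ν y c α β γ v₀ x n i j = (1 : Matrix (Fin J) (Fin J) ℝ) i j +
      ∑ k ∈ Finset.range n, (outer (grad ε ν y c (x k) (V ε ν y c α β γ v₀ x k)) i j +
        γ * (1 + (((k + 1) / J : ℕ) : ℝ)) ^ (-β) * outer (Z ν (k + 1)) i j) := by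
  induction n with
  | zero => simp [S_zero]
  | succ n ih =>
    rw [S_succ, Finset.sum_range_succ, ← add_assoc, ← ih, gradh_eq_grad hε hν hν_sum,
      Matrix.add_apply, Matrix.add_apply, Matrix.smul_apply, smul_eq_mul, add_assoc]

end Averages

/-! ### Almost sure convergence of `V n` and `S n / n`. -/

section Convergence

variable {J : ℕ} {Ω : Type*} [mΩ : MeasurableSpace Ω] {P : Measure Ω} [IsProbabilityMeasure P]
  {𝒳 𝒴 : Type*} [MeasurableSpace 𝒳] {μ : Measure 𝒳}
  {ε : ℝ} {ν : Fin J → ℝ} {y : Fin J → 𝒴} {c : 𝒳 → 𝒴 → ℝ} {α β γ : ℝ}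

theorem ae_tendsto_V [IsProbabilityMeasure μ] (hε : 0 < ε) (hν : ∀ j, 0 < ν j) (hν_sum : ∑ j, ν j = 1)
    (hc : ∀ j, Measurable fun x => c x (y j)) (hci : ∀ j, Integrable (fun x => c x (y j)) μ)
    (hc0 : ∀ x z, 0 ≤ c x z) (hα : 0 ≤ α) (hβ : 0 < β) (hαβ : α + β < 1 / 2) (hγ : 0 < γ)
    {vstar : EuclideanSpace ℝ (Fin J)} (hmin : ∀ w, H ε ν y c μ vstar ≤ H ε ν y c μ w)
    (hvstar : ∑ j, vstar j = 0)
    {X : ℕ → Ω → 𝒳} (hX : ∀ n, Measurable (X n)) (hX_law : ∀ n, P.map (X n) = μ)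
    (hX_indep : iIndepFun X P) {V₀ : Ω → EuclideanSpace ℝ (Fin J)} (hV₀ : Measurable V₀)
    (hV₀_sq : MemLp V₀ 2 P) (hV₀_indep : IndepFun V₀ (fun ω n => X n ω) P) :
    ∀ᵐ ω ∂P, Tendsto (fun n : ℕ => V ε ν y c α β γ (V₀ ω) (fun k => X k ω) n)
      atTop (𝓝 vstar) := by
  obtain ⟨κ, hκ, hlow⟩ := exists_le_inner_S (ε := ε) (y := y) (c := c) (α := α) hν hν_sum hβ
    (by linarith) hγ
  have hJ : 0 < J := by obtain ⟨i⟩ := nonempty_of_sum_eq_one hν_sum; exact i.pos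
  set v : ℕ → Ω → EuclideanSpace ℝ (Fin J) :=
    fun n ω => V ε ν y c α β γ (V₀ ω) (fun k => X k ω) n with hv_def
  set A : ℕ → Ω → Matrix (Fin J) (Fin J) ℝ :=
    fun n ω => S ε ν y c α β γ (V₀ ω) (fun k => X k ω) n with hA_def
  set m : ℕ → ℝ := fun n => κ * ((n : ℝ) + 1) ^ (1 - β) with hm_def
  have hm : ∀ n, 0 < m n := fun n => by positivity
  have hAlow : ∀ n ω u, m n * ‖u‖ ^ 2 ≤ inner ℝ u (mulE (A n ω) u) := fun n ω u =>
    hlow (V₀ ω) (fun k => X k ω) n u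
  set q : ℕ → Ω → EuclideanSpace ℝ (Fin J) :=
    fun n ω => ((n : ℝ) ^ α) • mulE (A n ω)⁻¹ (meanGrad ε ν y c μ (v n ω)) with hq_def
  set b : ℕ → ℝ := fun n => 4 / ε * ((n : ℝ) ^ α * (2 / m n)) ^ 2 with hb_def
  set Y : ℕ → Ω → ℝ := fun n ω => H ε ν y c μ (v n ω) - H ε ν y c μ vstar with hY_def
  set D : ℕ → Ω → ℝ := fun n ω => inner ℝ (q n ω) (meanGrad ε ν y c μ (v n ω)) with hD_def
  set ℱ := pastFiltration hV₀ hX with hℱ_def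
  have hiter : ∀ n, Measurable[ℱ n] (v n) ∧ ∀ i j, Measurable[ℱ n] fun ω => A n ω i j := fun n =>
    measurable_iter (m := ℱ n) hε hν hν_sum hc (comap_past_measurable_init V₀ X n) n
      fun k hk => comap_past_measurable_obs V₀ X hk
  have hgm : ∀ n, Measurable[ℱ n] fun ω => meanGrad ε ν y c μ (v n ω) := fun n =>
    (measurable_meanGrad hc).comp (hiter n).1
  have hqm : ∀ n, Measurable[ℱ n] (q n) := fun n =>
    (measurable_mulE (m := ℱ n) (measurable_inv_apply (m := ℱ n) (hiter n).2)
      (hgm n)).const_smul ((n : ℝ) ^ α)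
  have hqb : ∀ n ω, ‖q n ω‖ ≤ (n : ℝ) ^ α * (2 / m n) := fun n ω => by
    rw [hq_def]
    simp only
    rw [norm_smul, Real.norm_of_nonneg (by positivity)]
    refine mul_le_mul_of_nonneg_left ?_ (by positivity)
    exact (norm_mulE_inv_le (hm n) (hAlow n ω) _).trans
      (div_le_div_of_nonneg_right (norm_meanGrad_le hν hν_sum _) (hm n).le)
  have hqi : ∀ n, Integrable (q n) P := fun n =>
    Integrable.of_bound ((hqm n).mono (ℱ.le n) le_rfl).aestronglyMeasurable _
      (Eventually.of_forall (hqb n))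
  have hvm : ∀ n, Measurable (v n) := fun n => (hiter n).1.mono (ℱ.le n) le_rfl
  have hYm : ∀ n, Measurable[ℱ n] (Y n) := fun n =>
    ((continuous_H hε hν hν_sum hc hci hc0).measurable.comp (hiter n).1).sub_const _
  have hDm : ∀ n, Measurable[ℱ n] (D n) := fun n => (hqm n).inner (hgm n)
  have hY0 : ∀ n ω, 0 ≤ Y n ω := fun n ω => sub_nonneg.2 (hmin _)
  have hstep : ∀ n ω, Y (n + 1) ω ≤
      Y n ω - inner ℝ (q n ω) (grad ε ν y c (X n ω) (v n ω)) + b n := fun n ω => by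
    have := H_V_succ_le (μ := μ) (α := α) (β := β) (γ := γ) hε hν hν_sum hc hci hc0 (hm n)
      (hAlow n ω)
    simp only [hY_def, hq_def, hv_def, hA_def, hb_def]
    linarith
  have hgi : ∀ n, Integrable (fun ω => inner ℝ (q n ω) (grad ε ν y c (X n ω) (v n ω))) P :=
    fun n => integrable_inner_grad hν hν_sum hc (hX n) (hqi n) (hvm n)
  have hDi : ∀ n, Integrable (D n) P := fun n => by
    refine ((hqi n).norm.mul_const 2).mono'
      ((hDm n).mono (ℱ.le n) le_rfl).aestronglyMeasurable (Eventually.of_forall fun ω => ?_)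
    exact (norm_inner_le_norm _ _).trans
      (mul_le_mul_of_nonneg_left (norm_meanGrad_le hν hν_sum _) (norm_nonneg _))
  have hYi : ∀ n, Integrable (Y n) P := by
    intro n
    induction n with
    | zero =>
      -- Square integrability of `V₀` enters here: the gradient vanishes at `vstar`, so `H` exceeds
      -- its minimum by at most a quadratic.
      have h1 : Integrable (fun ω => 4 / ε * ‖V₀ ω - vstar‖ ^ 2) P :=
        ((hV₀_sq.sub (memLp_const vstar)).integrable_norm_pow two_ne_zero).const_mul _
      refine h1.mono' ((hYm 0).mono (ℱ.le 0) le_rfl).aestronglyMeasurable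
        (Eventually.of_forall fun ω => ?_)
      rw [Real.norm_of_nonneg (hY0 0 ω)]
      have h2 := H_le_quadratic (μ := μ) hε hν hν_sum hc hci hc0 vstar (V₀ ω)
      rw [meanGrad_eq_zero hε hν hν_sum hc hci hc0 hmin, inner_zero_left] at h2
      change H ε ν y c μ (V₀ ω) - H ε ν y c μ vstar ≤ _
      linarith
    | succ n ih =>
      refine ((ih.sub (hgi n)).add (integrable_const (b n))).mono'
        ((hYm _).mono (ℱ.le _) le_rfl).aestronglyMeasurable (Eventually.of_forall fun ω => ?_)
      rw [Real.norm_of_nonneg (hY0 _ ω)]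
      exact hstep n ω
  have hDlow : ∀ (n : ℕ) ω, (n : ℝ) ^ α * (‖meanGrad ε ν y c μ (v n ω)‖ ^ 2 /
      ((5 + γ) * ((n : ℝ) + 1))) ≤ D n ω := fun n ω => by
    simp only [hD_def, hq_def]
    rw [inner_smul_left, conj_trivial]
    refine mul_le_mul_of_nonneg_left ?_ (by positivity)
    rw [real_inner_comm]
    exact le_inner_mulE_inv (hm n) (by positivity) (S_transpose n) (hAlow n ω)
      (inner_S_le hε hν hν_sum hβ hγ n) _
  have hD0 : ∀ n ω, 0 ≤ D n ω := fun n ω => le_trans (by positivity) (hDlow n ω)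
  have hset : ∀ n (B : Set Ω), MeasurableSet[ℱ n] B →
      ∫ ω in B, Y (n + 1) ω ∂P ≤ ∫ ω in B, (Y n ω - D n ω + b n) ∂P := by
    intro n B hB
    have hB' : MeasurableSet B := ℱ.le n B hB
    -- Absorbing the indicator of the past event `B` into `q n` turns the set integral into a full
    -- expectation.
    have hqBm : Measurable[ℱ n] (B.indicator (q n)) := (hqm n).indicator hB
    have hind : IndepFun (fun ω => (B.indicator (q n) ω, v n ω)) (X n) P :=
      indep_of_indep_of_le_left (indepFun_past hV₀ hX hX_indep hV₀_indep n)
        (Measurable.comap_le (Measurable.prodMk (m := ℱ n) hqBm (hiter n).1))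
    have hcond : ∫ ω in B, inner ℝ (q n ω) (grad ε ν y c (X n ω) (v n ω)) ∂P =
        ∫ ω in B, D n ω ∂P := by
      rw [← integral_indicator hB', ← integral_indicator hB']
      have h1 := integral_inner_grad (ε := ε) hν hν_sum hc (hX n) (hX_law n)
        (hqBm.mono (ℱ.le n) le_rfl) ((hqi n).indicator hB') (hvm n) hind
      have h2 : ∀ g : Ω → EuclideanSpace ℝ (Fin J), (fun ω => inner ℝ (B.indicator (q n) ω) (g ω)) =
          B.indicator fun ω => inner ℝ (q n ω) (g ω) := fun g => by
        ext ω
        by_cases h : ω ∈ B <;> simp [h]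
      rwa [h2, h2] at h1
    have hi1 : Integrable (fun ω => Y n ω - inner ℝ (q n ω) (grad ε ν y c (X n ω) (v n ω))) P :=
      (hYi n).sub (hgi n)
    have hi2 : Integrable (fun ω => Y n ω - D n ω) P := (hYi n).sub (hDi n)
    calc ∫ ω in B, Y (n + 1) ω ∂P
        ≤ ∫ ω in B, (Y n ω - inner ℝ (q n ω) (grad ε ν y c (X n ω) (v n ω)) + b n) ∂P :=
          setIntegral_mono (hYi _).integrableOn (hi1.add (integrable_const _)).integrableOn
            (hstep n)
      _ = _ := by
          rw [integral_add hi1.integrableOn (integrable_const _),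
            integral_add hi2.integrableOn (integrable_const _),
            integral_sub (hYi n).integrableOn (hgi n).integrableOn,
            integral_sub (hYi n).integrableOn (hDi n).integrableOn, hcond]
  filter_upwards [ae_tendsto_and_summable_of_setIntegral_le
    (fun n => (hYm n).stronglyMeasurable) (fun n => (hDm n).stronglyMeasurable) hYi hDi hY0 hD0
    (fun n => by positivity) (summable_second_order hα hαβ hκ (4 / ε)) hset]
    with ω ⟨⟨l, hl⟩, hsum⟩
  refine tendsto_of_summable_norm_meanGrad hε hν hν_sum hc hci hc0 hmin hvstar
    (fun n => sum_V_succ hJ n) hl hsum (C := (5 + γ)⁻¹) (by positivity) ?_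
  -- The index 0 is excluded because `0 ^ α = 0` when `α > 0`; from 1 on, `n ^ α ≥ 1`.
  filter_upwards [eventually_ge_atTop 1] with n hn
  refine le_trans ?_ (hDlow n ω)
  have h1 : (1 : ℝ) ≤ (n : ℝ) ^ α := Real.one_le_rpow (by exact_mod_cast hn) hα
  calc (5 + γ)⁻¹ * ‖meanGrad ε ν y c μ (v n ω)‖ ^ 2 / ((n : ℝ) + 1)
      = 1 * (‖meanGrad ε ν y c μ (v n ω)‖ ^ 2 / ((5 + γ) * ((n : ℝ) + 1))) := by field_simp
    _ ≤ _ := by gcongr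

theorem ae_tendsto_outer_average (hε : 0 < ε) (hν : ∀ j, 0 < ν j) (hν_sum : ∑ j, ν j = 1)
    (hc : ∀ j, Measurable fun x => c x (y j))
    {X : ℕ → Ω → 𝒳} (hX : ∀ n, Measurable (X n)) (hX_law : ∀ n, P.map (X n) = μ)
    (hX_indep : iIndepFun X P) (v : EuclideanSpace ℝ (Fin J)) (i j : Fin J) :
    ∀ᵐ ω ∂P, Tendsto (fun n : ℕ => (n : ℝ)⁻¹ *
      ∑ k ∈ Finset.range n, outer (grad ε ν y c (X k ω) v) i j) atTop (𝓝 (G ε ν y c μ v i j)) := by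
  set f : 𝒳 → ℝ := fun x => outer (grad ε ν y c x v) i j with hf
  have hfm : Measurable f := by
    have := measurable_grad (ε := ε) (ν := ν) hc measurable_id (measurable_const (a := v))
    exact (measurable_coord this i).mul (measurable_coord this j)
  have hfb : ∀ x, ‖f x‖ ≤ 2 * 2 := fun x => by
    change ‖grad ε ν y c x v i * grad ε ν y c x v j‖ ≤ _
    rw [norm_mul]
    exact mul_le_mul (abs_coord_grad_le hν hν_sum x v i) (abs_coord_grad_le hν hν_sum x v j)
      (norm_nonneg _) two_pos.le
  have h1 := strong_law_ae_real (μ := P) (fun n ω => f (X n ω))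
    (Integrable.of_bound (hfm.comp (hX 0)).aestronglyMeasurable _
      (Eventually.of_forall fun ω => hfb _))
    (fun k l hkl => (hX_indep.indepFun hkl).comp hfm hfm)
    (fun k => IdentDistrib.comp (f := X k) (g := X 0)
      ⟨(hX k).aemeasurable, (hX 0).aemeasurable, by rw [hX_law, hX_law]⟩ hfm)
  have h2 : ∫ ω, f (X 0 ω) ∂P = G ε ν y c μ v i j := by
    rw [← integral_map (hX 0).aemeasurable hfm.aestronglyMeasurable, hX_law]
    change _ = ∫ x, outer (gradh ε ν y c x v) i j ∂μ
    simp only [gradh_eq_grad hε hν hν_sum, hf]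
  filter_upwards [h1] with ω hω
  rw [h2] at hω
  simpa only [div_eq_inv_mul] using hω

theorem ae_tendsto_S (hε : 0 < ε) (hν : ∀ j, 0 < ν j) (hν_sum : ∑ j, ν j = 1)
    (hc : ∀ j, Measurable fun x => c x (y j)) (hβ : 0 < β)
    {vstar : EuclideanSpace ℝ (Fin J)}
    {X : ℕ → Ω → 𝒳} (hX : ∀ n, Measurable (X n)) (hX_law : ∀ n, P.map (X n) = μ)
    (hX_indep : iIndepFun X P) {V₀ : Ω → EuclideanSpace ℝ (Fin J)}
    (hV : ∀ᵐ ω ∂P, Tendsto (fun n : ℕ => V ε ν y c α β γ (V₀ ω) (fun k => X k ω) n)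
      atTop (𝓝 vstar)) :
    ∀ᵐ ω ∂P, Tendsto
      (fun n : ℕ => (n : ℝ)⁻¹ • S ε ν y c α β γ (V₀ ω) (fun k => X k ω) n)
      atTop (𝓝 (G ε ν y c μ vstar)) := by
  have hJ : 0 < J := by obtain ⟨i⟩ := nonempty_of_sum_eq_one hν_sum; exact i.pos
  have hlaw : ∀ᵐ ω ∂P, ∀ i j, Tendsto (fun n : ℕ => (n : ℝ)⁻¹ *
      ∑ k ∈ Finset.range n, outer (grad ε ν y c (X k ω) vstar) i j) atTop
      (𝓝 (G ε ν y c μ vstar i j)) :=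
    ae_all_iff.2 fun i => ae_all_iff.2 fun j =>
      ae_tendsto_outer_average hε hν hν_sum hc hX hX_law hX_indep vstar i j
  filter_upwards [hV, hlaw] with ω hVω hω
  refine tendsto_pi_nhds.2 fun i => tendsto_pi_nhds.2 fun j => ?_
  -- `S n / n` splits into the initial identity over `n`, the Cesàro mean of terms tending to 0
  -- (replacement error and regularization), and the i.i.d. average at `vstar`.
  have h1 := ((tendsto_outer_sub (y := y) (c := c) hε hν hν_sum hVω (fun k => X k ω) i j).add
    (tendsto_regularization (γ := γ) hJ hν hν_sum hβ i j)).cesaro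
  have h2 := (tendsto_inv_atTop_nhds_zero_nat (𝕜 := ℝ)).mul_const
    ((1 : Matrix (Fin J) (Fin J) ℝ) i j)
  have h3 := (h2.add h1).add (hω i j)
  simp only [zero_mul, add_zero, zero_add] at h3
  refine h3.congr fun n => ?_
  change _ = (n : ℝ)⁻¹ * S ε ν y c α β γ (V₀ ω) (fun k => X k ω) n i j
  rw [S_apply_eq_sum hε hν hν_sum, ← mul_add, ← mul_add, add_assoc, ← Finset.sum_add_distrib]
  congr 2
  exact Finset.sum_congr rfl fun k _ => by ring

end Convergence

end SGN

end

theorem theorem3 {𝒳 𝒴 Ω : Type*}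
    [MetricSpace 𝒳] [MeasurableSpace 𝒳] [BorelSpace 𝒳] [MetricSpace 𝒴]
    -- the source measure
    (μ : Measure 𝒳) [IsProbabilityMeasure μ]
    -- the target measure, with atoms `y j` and positive weights `ν j`
    {J : ℕ} (y : Fin J → 𝒴) (ν : Fin J → ℝ) (hν : ∀ j, 0 < ν j) (hν_sum : ∑ j, ν j = 1)
    -- the cost function
    (c : 𝒳 → 𝒴 → ℝ) (hc : LowerSemicontinuous (Function.uncurry c))
    (cX : 𝒳 → ℝ) (cY : 𝒴 → ℝ) (hcX : Integrable cX μ)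
    (hc_nonneg : ∀ x z, 0 ≤ c x z) (hc_le : ∀ x z, c x z ≤ cX x + cY z)
    -- the parameters
    (ε : ℝ) (hε : 0 < ε) (α β γ : ℝ) (hα : 0 ≤ α) (hβ : 0 < β) (hαβ : α + β < 1 / 2)
    (hγ : 0 < γ)
    -- the normalized minimizer of the semi-dual objective
    (vstar : EuclideanSpace ℝ (Fin J))
    (hmin : ∀ v, SGN.H ε ν y c μ vstar ≤ SGN.H ε ν y c μ v)
    (hvstar : vstar ∈ (Submodule.span ℝ {SGN.vJ J})ᗮ)
    -- the i.i.d. sample (`X n` is the `(n + 1)`-st observation) and the initial value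
    [MeasurableSpace Ω] (P : Measure Ω) [IsProbabilityMeasure P]
    (X : ℕ → Ω → 𝒳) (hX : ∀ n, Measurable (X n)) (hX_law : ∀ n, P.map (X n) = μ)
    (hX_indep : iIndepFun X P)
    (V₀ : Ω → EuclideanSpace ℝ (Fin J)) (hV₀ : Measurable V₀) (hV₀_sq : MemLp V₀ 2 P)
    (hV₀_mem : ∀ᵐ ω ∂P, V₀ ω ∈ (Submodule.span ℝ {SGN.vJ J})ᗮ)
    (hV₀_indep : IndepFun V₀ (fun ω n => X n ω) P) :
    (∀ᵐ ω ∂P, Tendsto (fun n : ℕ => SGN.V ε ν y c α β γ (V₀ ω) (fun k => X k ω) n)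
      atTop (𝓝 vstar)) ∧
    (∀ᵐ ω ∂P, Tendsto
      (fun n : ℕ => (n : ℝ)⁻¹ • SGN.S ε ν y c α β γ (V₀ ω) (fun k => X k ω) n)
      atTop (𝓝 (SGN.G ε ν y c μ vstar))) := by
  have hJ : 0 < J := by obtain ⟨i⟩ := SGN.nonempty_of_sum_eq_one hν_sum; exact i.pos
  -- Only the sections of `c` at the atoms matter; each is lower semicontinuous, hence Borel.
  have hcm : ∀ j, Measurable fun x => c x (y j) := fun j =>
    (LowerSemicontinuous.comp (g := fun x => (x, y j)) hc (by fun_prop)).measurable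
  have hci : ∀ j, Integrable (fun x => c x (y j)) μ := fun j =>
    (hcX.add (integrable_const (cY (y j)))).mono' (hcm j).aestronglyMeasurable
      (Eventually.of_forall fun x => by
        rw [Real.norm_of_nonneg (hc_nonneg _ _)]
        exact hc_le x (y j))
  have hV := SGN.ae_tendsto_V (γ := γ) hε hν hν_sum hcm hci hc_nonneg hα hβ hαβ hγ hmin
    ((SGN.mem_orthogonal_vJ_iff hJ vstar).1 hvstar) hX hX_law hX_indep hV₀ hV₀_sq hV₀_indep
  exact ⟨hV, SGN.ae_tendsto_S hε hν hν_sum hcm hβ hX hX_law hX_indep hV⟩
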